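/- Let $n,d\ge 1$ be integers. Let $\mathfrak{gl}_d$ be the space of complex $d\times d$ matrices and $\mathfrak{gl}_d^{rs}\subset\mathfrak{gl}_d$ the open subset of diagonalizable matrices with pairwise distinct eigenvalues. Let $\mathcal F$ be the space of $n$-step partial flags $F=(0=F_0\subseteq F_1\subseteq\dots\subseteq F_n=\mathbb C^d)$ (inclusions not necessarily proper), let $M^\perp=\{(x,F)\in\mathfrak{gl}_d\times\mathcal F \mid x(F_j)\subseteq F_j \text{ for all } j\}$, and let $\tilde\mu:M^\perp\to\mathfrak{gl}_d$, $(x,F)\mapsto x$. Then the sheaf $\mathcal L=\tilde\mu_*\mathbb C_{M^\perp}|_{\mathfrak{gl}_d^{rs}}$ is a local system. Let $x\in\mathfrak{gl}_d^{rs}$, and let $e_1,\dots,e_d$ be a basis of $\mathbb C^d$ with $xe_i=\lambda_ie_i$. For $\varphi:\{1,\dots,d\}\to\{1,\dots,n\}$ let $F^\varphi\in\tilde\mu^{-1}(x)$ be the flag with $F^\varphi_j=\operatorname{span}\{e_i\mid \varphi(i)\le j\}$. For every basis $f_1,\dots,f_n$ of $\mathbb C^n$ there is a linear isomorphism $$T:\mathcal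 L_x\to(\mathbb C^n)^{\otimes d},\qquad T(s_x)=\sum_{\varphi} s(x,F^\varphi)\, f_{\varphi(1)}\otimes\dots\otimes f_{\varphi(d)},$$ where $s_x$ is the germ at $x$ of a section $s$ of $\mathcal L$ near $x$, that is, of a locally constant function on the preimage under $\tilde\mu$ of a neighbourhood of $x$. Under this identification, the monodromy action of $\pi_1(\mathfrak{gl}_d^{rs},x)$ on $\mathcal L_x\cong(\mathbb C^n)^{\otimes d}$ factors through the natural representation of the symmetric group $S_d$, $\sigma(v_1\otimes\dots\otimes v_d)=v_{\sigma^{-1}(1)}\otimes\dots\otimes v_{\sigma^{-1}(d)}$: there is a surjective group homomorphism $\rho:\pi_1(\mathfrak{gl}_d^{rs},x)\to S_d$, independent of the choice of $f_1,\dots,f_n$, such that $T(\gamma\cdot a)=\rho(\gamma)\,T(a)$ for all $\gamma\in\pi_1(\mathfrak{gl}_d^{rs},x)$ and $a\in\mathcal L_x$. Here $\rho$ is the permutation of the eigenvalues of $x$ along loops: for every loop $\gamma$ at $x$ and every $i$, some continuous function $l:[0,1]\to\mathbb C$ with $l(t)$ an eigenvalue of $\gamma(t)$ for all $t$ satisfies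 $l(0)=\lambda_i$ and $l(1)=\lambda_{\rho(\gamma)(i)}$. (Products in $\pi_1$ are ordered so that $\gamma\gamma'$ means first $\gamma'$, then $\gamma$.) -/

import Mathlib

open CategoryTheory TopologicalSpace Opposite
open scoped TensorProduct

noncomputable section

namespace FlagMonodromy

/-- The constant sheaf `V_X`: its sections over an open `U` are the locally constant functions
`U → V`. -/
def constPresheaf (X : TopCat.{0}) (V : ModuleCat.{0} ℂ) : TopCat.Presheaf (ModuleCat.{0} ℂ) X where
  obj U := ModuleCat.of ℂ (LocallyConstant (U.unop : Opens X) V)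
  map {U W} i := ModuleCat.ofHom
    (LocallyConstant.comapₗ ℂ ⟨Set.inclusion i.unop.le, continuous_inclusion i.unop.le⟩)
  map_id U := by
    ext s
    rfl
  map_comp i j := by
    ext s
    rfl

theorem constPresheaf_isSheaf (X : TopCat.{0}) (V : ModuleCat.{0} ℂ) :
    (constPresheaf X V).IsSheaf := by
  rw [TopCat.Presheaf.isSheaf_iff_isSheafUniqueGluing]
  intro ι U sf hsf
  let g : ∀ i : ι, LocallyConstant (U i : Opens X) V := sf
  have key : ∀ (i j : ι) (x : X) (hi : x ∈ U i) (hj : x ∈ U j), g i ⟨x, hi⟩ = g j ⟨x, hj⟩ := by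
    intro i j x hi hj
    exact DFunLike.congr_fun (F := LocallyConstant (U i ⊓ U j : Opens X) V) (hsf i j) ⟨x, hi, hj⟩
  have hm : ∀ x : (iSup U : Opens X), ∃ i, (x : X) ∈ U i := fun x => Opens.mem_iSup.1 x.2
  choose k hk using hm
  refine ⟨(⟨fun x => g (k x) ⟨x, hk x⟩, ?_⟩ : LocallyConstant (iSup U : Opens X) V), ?_, ?_⟩
  · rw [IsLocallyConstant.iff_exists_open]
    intro x
    obtain ⟨W, hW, hxW, hWc⟩ := (g (k x)).isLocallyConstant.exists_open ⟨x, hk x⟩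
    obtain ⟨W', hW', rfl⟩ := isOpen_induced_iff.1 hW
    refine ⟨Subtype.val ⁻¹' (W' ∩ U (k x)),
      (hW'.inter (U (k x)).isOpen).preimage continuous_subtype_val, ⟨hxW, hk x⟩, ?_⟩
    rintro y ⟨hy, hy'⟩
    exact (key _ _ _ _ _).trans (hWc ⟨y, hy'⟩ hy)
  · intro i
    refine LocallyConstant.ext (X := (U i : Opens X)) (Y := V) fun x => ?_
    exact key _ _ _ _ _
  · intro t ht
    refine LocallyConstant.ext (X := (iSup U : Opens X)) (Y := V) fun x => ?_
    exact DFunLike.congr_fun (F := LocallyConstant (U (k x) : Opens X) V) (ht (k x)) ⟨x, hk x⟩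

/-- The constant sheaf on `X` with stalk the complex vector space `V`. -/
def constSheaf (X : TopCat.{0}) (V : ModuleCat.{0} ℂ) : X.Sheaf (ModuleCat.{0} ℂ) :=
  ⟨constPresheaf X V, constPresheaf_isSheaf X V⟩

/-- A local system: a sheaf of complex vector spaces which is locally isomorphic to a constant
sheaf with finite-dimensional stalk. -/
def IsLocalSystem {X : TopCat.{0}} (F : X.Sheaf (ModuleCat.{0} ℂ)) : Prop :=
  ∀ x : X, ∃ U : Opens X, x ∈ U ∧ ∃ V : ModuleCat.{0} ℂ, Module.Finite ℂ V ∧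
    Nonempty (U.sheafRestrict.obj F ≅ constSheaf (TopCat.of U) V)


/-- The étalé space of a local system is a covering of the base. -/
theorem IsLocalSystem.isCoveringMap {X : TopCat.{0}} [LocallyConnectedSpace X]
    {F : X.Sheaf (ModuleCat.{0} ℂ)} (hF : IsLocalSystem F) :
    IsCoveringMap (TopCat.Presheaf.EtaleSpace.base (F := F.presheaf)) := by
  refine TopCat.Presheaf.EtaleSpace.isCoveringMap_base fun x => ?_
  obtain ⟨U, hxU, V, -, ⟨e⟩⟩ := hF x
  obtain ⟨W, hWU, hW, hxW, hWc⟩ :=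
    locallyConnectedSpace_iff_subsets_isOpen_isConnected.1 ‹_› x U (U.isOpen.mem_nhds hxU)
  let j : Opens U ⥤ Opens X := U.isOpenEmbedding.isOpenMap.functor
  let e' : j.op ⋙ F.presheaf ≅ constPresheaf (TopCat.of U) V :=
    (sheafToPresheaf _ _).mapIso e
  let r (N : Opens X) : Opens U := ⟨Subtype.val ⁻¹' N, N.isOpen.preimage continuous_subtype_val⟩
  let W0 : Opens U := r ⟨W, hW⟩
  have hW0 : IsPreconnected (W0 : Set U) := by
    rw [← Topology.IsInducing.subtypeVal.isPreconnected_image]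
    have : (Subtype.val '' (W0 : Set U) : Set X) = W := by
      ext z
      exact ⟨by rintro ⟨u, hu, rfl⟩; exact hu, fun hz => ⟨⟨z, hWU hz⟩, hz, rfl⟩⟩
    exact this ▸ hWc.isPreconnected
  have hjr : ∀ N : Opens X, j.obj (r N) ≤ N := by
    rintro N _ ⟨u, hu, rfl⟩
    exact hu
  -- the locally constant function attached to a section
  let f (N : Opens U) (s : F.presheaf.obj (op (j.obj N))) : LocallyConstant N V :=
    e'.hom.app (op N) s
  have hf : ∀ N : Opens U, Function.Injective (f N) := fun N =>
    (ConcreteCategory.bijective_of_isIso (e'.hom.app (op N))).1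
  have hfs : ∀ N : Opens U, Function.Surjective (f N) := fun N =>
    (ConcreteCategory.bijective_of_isIso (e'.hom.app (op N))).2
  have hnat : ∀ (N M : Opens U) (i : N ⟶ M) (s : F.presheaf.obj (op (j.obj M))) (z : N),
      f N (F.presheaf.map (j.map i).op s) z = f M s ⟨z, i.le z.2⟩ := by
    intro N M i s z
    have := ConcreteCategory.congr_hom (e'.hom.naturality i.op) s
    exact DFunLike.congr_fun (F := LocallyConstant N V) this z
  refine ⟨j.obj W0, ⟨⟨x, hxU⟩, hxW, rfl⟩, ?_⟩
  rintro _ ⟨y, hy, rfl⟩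
  constructor
  · intro s t hst
    obtain ⟨N, hyN, i₁, i₂, hN⟩ := F.presheaf.germ_eq _ _ _ _ _ hst
    have hNW : r N ≤ W0 := by
      intro z hz
      obtain ⟨z', hz', hzz⟩ := i₁.le hz
      rwa [← Subtype.ext hzz]
    have h1 : F.presheaf.map (j.map (homOfLE hNW)).op s
        = F.presheaf.map (j.map (homOfLE hNW)).op t := by
      have := congrArg (F.presheaf.map (homOfLE (hjr N)).op) hN
      rw [← ConcreteCategory.comp_apply, ← ConcreteCategory.comp_apply, ← Functor.map_comp,
        ← Functor.map_comp] at this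
      exact this
    have h2 : f W0 s ⟨y, hy⟩ = f W0 t ⟨y, hy⟩ := by
      have := hnat _ _ (homOfLE hNW) s ⟨y, hyN⟩
      rw [h1, hnat] at this
      exact this.symm
    have : PreconnectedSpace W0 := Subtype.preconnectedSpace hW0
    refine hf _ (LocallyConstant.ext fun z => ?_)
    rw [(f W0 s).apply_eq_of_preconnectedSpace z ⟨y, hy⟩,
      (f W0 t).apply_eq_of_preconnectedSpace z ⟨y, hy⟩, h2]
  · intro a
    obtain ⟨N, hNW, hyN, s, rfl⟩ := F.presheaf.exists_le_germ_eq a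
      (V := j.obj W0) ⟨y, hy, rfl⟩
    have hrN : r N ≤ W0 := by
      intro z hz
      obtain ⟨z', hz', hzz⟩ := hNW hz
      rwa [← Subtype.ext hzz]
    let s1 := F.presheaf.map (homOfLE (hjr N)).op s
    obtain ⟨Q, hQ, hyQ, hQc⟩ := (f (r N) s1).isLocallyConstant.exists_open ⟨y, hyN⟩
    obtain ⟨Q', hQ', rfl⟩ := isOpen_induced_iff.1 hQ
    obtain ⟨t, ht⟩ := hfs W0 (LocallyConstant.const _ (f (r N) s1 ⟨y, hyN⟩))
    refine ⟨t, ?_⟩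
    let Q0 : Opens U := ⟨Q', hQ'⟩ ⊓ r N
    have hQN : Q0 ≤ r N := inf_le_right
    refine F.presheaf.germ_ext (j.obj Q0) ⟨y, ⟨hyQ, hyN⟩, rfl⟩ (j.map (homOfLE (hQN.trans hrN)))
      (j.map (homOfLE hQN) ≫ homOfLE (hjr N)) ?_
    have h3 : F.presheaf.map (j.map (homOfLE hQN) ≫ homOfLE (hjr N)).op s
        = F.presheaf.map (j.map (homOfLE hQN)).op s1 := by
      rw [op_comp, Functor.map_comp, ConcreteCategory.comp_apply]
    rw [h3]
    refine hf _ (LocallyConstant.ext fun z => ?_)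
    rw [hnat, hnat, ht]
    exact (hQc ⟨z, z.2.2⟩ z.2.1).symm

/-- The fibre of the étalé space over `x` is the stalk at `x`. -/
def fiberEquivStalk {X : TopCat.{0}} (F : X.Sheaf (ModuleCat.{0} ℂ)) (x : X) :
    (TopCat.Presheaf.EtaleSpace.base (F := F.presheaf)) ⁻¹' {x} ≃ F.presheaf.stalk x where
  toFun p := cast (congrArg (fun y => (F.presheaf.stalk y : Type)) p.2) p.1.germ
  invFun s := ⟨⟨x, s⟩, rfl⟩
  left_inv := by
    rintro ⟨⟨y, s⟩, hy⟩
    obtain rfl : y = x := hy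
    rfl
  right_inv s := rfl

/-- The monodromy action of the fundamental group on the stalk of a local system: a loop acts by
continuing germs along it, i.e. by lifting it to the étalé space. The product `γ * γ'` in
`FundamentalGroup` is the class of the path which first follows `γ'` and then `γ`, so this is a
left action. -/
def monodromyAction {X : TopCat.{0}} [LocallyConnectedSpace X]
    {F : X.Sheaf (ModuleCat.{0} ℂ)} (hF : IsLocalSystem F) (x : X) :
    FundamentalGroup X x →* Equiv.Perm (F.presheaf.stalk x) :=
  (fiberEquivStalk F x).permCongrHom.toMonoidHom.comp (hF.isCoveringMap.monodromyPerm x)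

/-- The Lie algebra `gl_d` of complex `d × d` matrices, with its usual topology. -/
abbrev gl (d : ℕ) : Type := Matrix (Fin d) (Fin d) ℂ
/-- The space `ℂ^d`; the inner product is used only to describe the topology on flags. -/
abbrev Cd (d : ℕ) : Type := EuclideanSpace ℂ (Fin d)

/-- A basis of `ℂ^d` in which `x` is diagonal. -/
structure EigenBasis {d : ℕ} (x : gl d) where
  vec : Module.Basis (Fin d) ℂ (Cd d)
  val : Fin d → ℂ
  apply_vec : ∀ i, Matrix.toEuclideanLin x (vec i) = val i • vec i

/-- Regular semisimple matrices: diagonalizable with pairwise distinct eigenvalues. -/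
def IsRegularSemisimple {d : ℕ} (x : gl d) : Prop :=
  ∃ e : EigenBasis x, Function.Injective e.val

theorem isRegularSemisimple_iff {d : ℕ} (x : gl d) :
    IsRegularSemisimple x ↔ x.charpoly.Separable := by
  have hch : (Matrix.toEuclideanLin x).charpoly = x.charpoly := by
    rw [Matrix.toEuclideanLin_eq_toLin_orthonormal, Matrix.charpoly_toLin]
  constructor
  · rintro ⟨e, he⟩
    have : Matrix.toEuclideanLin x = Matrix.toLin e.vec e.vec (Matrix.diagonal e.val) := by
      refine e.vec.ext fun i => ?_
      simp [e.apply_vec, Matrix.toLin_self, Matrix.diagonal_apply]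
    rw [← hch, this, Matrix.charpoly_toLin, Matrix.charpoly_diagonal]
    exact Polynomial.separable_prod_X_sub_C_iff.2 he
  · intro h
    have hn : x.charpoly.roots.Nodup := Polynomial.nodup_roots h
    have hc : x.charpoly.roots.toFinset.card = d := by
      rw [Multiset.toFinset_card_of_nodup hn, IsAlgClosed.card_roots_eq_natDegree,
        Matrix.charpoly_natDegree_eq_dim, Fintype.card_fin]
    let l : Fin d → ℂ := fun i => (x.charpoly.roots.toFinset.equivFinOfCardEq hc).symm i
    have hl : Function.Injective l := Subtype.val_injective.comp (Equiv.injective _)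
    have hev : ∀ i, Module.End.HasEigenvalue (Matrix.toEuclideanLin x) (l i) := by
      intro i
      rw [Module.End.hasEigenvalue_iff_isRoot_charpoly, hch]
      exact Polynomial.isRoot_of_mem_roots
        (Multiset.mem_toFinset.1 ((x.charpoly.roots.toFinset.equivFinOfCardEq hc).symm i).2)
    choose v hv using fun i => (hev i).exists_hasEigenvector
    have hli := Module.End.eigenvectors_linearIndependent' _ l hl v hv
    refine ⟨⟨basisOfLinearIndependentOfCardEqFinrank' v hli (by simp), l, fun i => ?_⟩, hl⟩
    simpa using (hv i).apply_eq_smul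

theorem isOpen_regularSemisimple (d : ℕ) : IsOpen {x : gl d | IsRegularSemisimple x} := by
  have hcoef : ∀ k : ℕ, Continuous fun x : gl d => x.charpoly.coeff k := by
    intro k
    have : (fun x : gl d => x.charpoly.coeff k) = fun x : gl d =>
        MvPolynomial.eval (fun p : Fin d × Fin d => x p.1 p.2)
          ((Matrix.charpoly.univ ℂ (Fin d)).coeff k) := by
      funext x
      have := Matrix.charpoly.univ_coeff_eval₂Hom (n := Fin d) (RingHom.id ℂ) (fun p => x p.1 p.2) k
      exact this.symm
    rw [this]
    refine (MvPolynomial.continuous_eval _).comp ?_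
    fun_prop
  have hiff : ∀ x : gl d, IsRegularSemisimple x ↔
      Polynomial.resultant x.charpoly (Polynomial.derivative x.charpoly) d (d - 1) ≠ 0 := by
    intro x
    have h1 : x.charpoly.natDegree = d := by simp [Matrix.charpoly_natDegree_eq_dim]
    have h2 : (Polynomial.derivative x.charpoly).natDegree = d - 1 := by
      rw [Polynomial.natDegree_derivative, h1]
    have := Polynomial.isUnit_resultant_iff_isCoprime (g := Polynomial.derivative x.charpoly)
      (Matrix.charpoly_monic x)
    rw [h1, h2, isUnit_iff_ne_zero] at this
    rw [isRegularSemisimple_iff, this]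
    rfl
  simp only [hiff]
  refine isOpen_ne_fun ?_ continuous_const
  unfold Polynomial.resultant
  refine Continuous.matrix_det ?_
  refine continuous_matrix fun i j => ?_
  unfold Polynomial.sylvester
  simp only [Matrix.of_apply]
  induction j using Fin.addCases <;> simp only [Fin.addCases_left, Fin.addCases_right] <;>
    split_ifs <;> first | exact continuous_const | skip
  all_goals first | exact hcoef _ | (simp only [Polynomial.coeff_derivative]; exact (hcoef _).mul continuous_const)

/-- The open subset of regular semisimple elements of `gl_d`. -/
def glrs (d : ℕ) : Opens (gl d) := ⟨{x | IsRegularSemisimple x}, isOpen_regularSemisimple d⟩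

instance (d : ℕ) : LocallyConnectedSpace (glrs d) :=
  haveI : LocallyConnectedSpace (gl d) := inferInstanceAs (LocallyConnectedSpace (Fin d → Fin d → ℂ))
  (glrs d).isOpen.locallyConnectedSpace

/-- An `n`-step partial flag `0 = F_0 ⊆ F_1 ⊆ ⋯ ⊆ F_n = ℂ^d`, inclusions not necessarily proper. -/
@[ext]
structure PartialFlag (n d : ℕ) where
  space : Fin (n + 1) → Submodule ℂ (Cd d)
  mono : Monotone space
  zero_eq : space 0 = ⊥
  last_eq : space (Fin.last n) = ⊤

/-- The usual topology on the space of flags: a subspace is identified with the orthogonal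
projection onto it, so flags form a subspace of a product of spaces of endomorphisms. -/
instance (n d : ℕ) : TopologicalSpace (PartialFlag n d) :=
  TopologicalSpace.induced (fun F j => (F.space j).starProjection) inferInstance

/-- Pairs `(x, F)` of a matrix and an `n`-step flag with `x F_j ⊆ F_j` for all `j`. -/
abbrev Mperp (n d : ℕ) : Type :=
  {p : gl d × PartialFlag n d // ∀ j, ∀ v ∈ p.2.space j, Matrix.toEuclideanLin p.1 v ∈ p.2.space j}

/-- The projection `(x, F) ↦ x`. -/
def muTilde (n d : ℕ) : TopCat.of (Mperp n d) ⟶ TopCat.of (gl d) :=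
  TopCat.ofHom ⟨fun p => p.1.1, by fun_prop⟩

/-- The direct image of the constant sheaf `ℂ` under `muTilde`. -/
def muTildePushforward (n d : ℕ) : (TopCat.of (gl d)).Sheaf (ModuleCat.{0} ℂ) :=
  (TopCat.Sheaf.pushforward _ (muTilde n d)).obj (constSheaf _ (ModuleCat.of ℂ ℂ))

/-- The restriction of the direct image of the constant sheaf to the regular semisimple locus. -/
def muTildeSheafRS (n d : ℕ) : (TopCat.of (glrs d)).Sheaf (ModuleCat.{0} ℂ) :=
  (Opens.sheafRestrict (X := TopCat.of (gl d)) (glrs d)).obj (muTildePushforward n d)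

/-- The flag attached to `φ : {1,…,d} → {1,…,n}`: `F_j` is spanned by the basis vectors `b_i` with
`φ i ≤ j`. The values of `φ` are numbered from `0` here, whence the strict inequality. -/
def flagOfMap {n d : ℕ} (b : Module.Basis (Fin d) ℂ (Cd d)) (φ : Fin d → Fin n) :
    PartialFlag n d where
  space j := Submodule.span ℂ (b '' {i | (φ i).castSucc < j})
  mono j k hjk := Submodule.span_mono (Set.image_mono fun i hi => lt_of_lt_of_le hi hjk)
  zero_eq := by simp
  last_eq := by simp [Fin.castSucc_lt_last]

/-- `φ i` is the minimal index `j` with `b_i ∈ F_j` (up to the shift of the numbering). -/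
theorem mem_flagOfMap_iff {n d : ℕ} (b : Module.Basis (Fin d) ℂ (Cd d)) (φ : Fin d → Fin n)
    (i : Fin d) (j : Fin (n + 1)) :
    b i ∈ (flagOfMap b φ).space j ↔ (φ i).castSucc < j := by
  change b i ∈ Submodule.span ℂ (b '' {i | (φ i).castSucc < j}) ↔ _
  rw [Module.Basis.mem_span_image]
  simp

/-- The point of the fibre of `muTilde` over `x` attached to `φ`. -/
def EigenBasis.fiberPoint {n d : ℕ} {x : gl d} (e : EigenBasis x) (φ : Fin d → Fin n) :
    Mperp n d :=
  ⟨(x, flagOfMap e.vec φ), fun j => by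
    change (flagOfMap e.vec φ).space j ≤
      Submodule.comap (Matrix.toEuclideanLin x) ((flagOfMap e.vec φ).space j)
    refine Submodule.span_le.2 ?_
    rintro _ ⟨i, hi, rfl⟩
    change Matrix.toEuclideanLin x (e.vec i) ∈ (flagOfMap e.vec φ).space j
    rw [e.apply_vec]
    exact Submodule.smul_mem _ _ (Submodule.subset_span ⟨i, hi, rfl⟩)⟩
/-- The natural representation of `S_d` on the `d`-th tensor power of `ℂ^n`:
`σ (v_1 ⊗ ⋯ ⊗ v_d) = v_{σ⁻¹ 1} ⊗ ⋯ ⊗ v_{σ⁻¹ d}`. -/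
def tensorPerm (n d : ℕ) :
    Representation ℂ (Equiv.Perm (Fin d)) (⨂[ℂ] _ : Fin d, (Fin n → ℂ)) where
  toFun σ := (PiTensorProduct.reindex ℂ (fun _ => Fin n → ℂ) σ).toLinearMap
  map_one' := LinearMap.ext fun v => LinearEquiv.congr_fun (PiTensorProduct.reindex_refl) v
  map_mul' σ τ := LinearMap.ext fun v =>
    (LinearEquiv.congr_fun (PiTensorProduct.reindex_trans (s := fun _ => Fin n → ℂ) τ σ) v).symm

/-- A section over `U` of the direct image is a locally constant function on the preimage of `U`;
this is its value at a point of the fibre over `x ∈ U`. -/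
def evalAt {n d : ℕ} {U : Opens (TopCat.of (glrs d))} (s : (muTildeSheafRS n d).presheaf.obj (op U))
    (x : glrs d) (hx : x ∈ U) (F : Mperp n d) (hF : F.1.1 = x.1) : ℂ :=
  (show LocallyConstant _ ℂ from s) ⟨F, ⟨x, hx, hF.symm⟩⟩

end FlagMonodromy

end

open FlagMonodromy

noncomputable section

namespace FlagMonodromy

open Polynomial Topology

/-! ### Eigenbases -/

namespace EigenBasis

variable {n d : ℕ} {x : gl d}

/-! A subspace stable under a regular semisimple `x` is spanned by the eigenvectors it contains, so
the fibre of `muTilde` over `x` is the finite set of flags `F^φ`, and `F^φ` depends only on the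
numbering of the eigenvalues. Simple eigenvalues can be numbered continuously near `x`
(`exists_local_eigenBasis`), and `F^φ` then varies continuously (`continuous_fiberPoint`). Hence
`muTilde` is locally a trivial finite covering, its direct image is locally constant, and a germ at
`x` amounts to an arbitrary function of `φ` (`stalkEquiv`). Sending the indicator function of `φ` to
`f_{φ(1)} ⊗ ⋯ ⊗ f_{φ(d)}` gives `T`.

Continuity of the flags is the analytic point, as their topology is defined by orthogonal
projections. The span of some eigenvectors is the range of a Lagrange polynomial in `x`, an
idempotent continuous in `x` and its eigenvalues, and the orthogonal projection onto the range of an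
idempotent is a continuous function of it.

For the monodromy, `ρ` is the monodromy of the covering by pairs (matrix, eigenvalue). If the
numbering of the eigenvalues is carried along a loop and returns permuted by `σ`, the point numbered
`φ ∘ σ` ends at `F^φ`. The value of a continued germ at a continued point is constant, so the
coordinate of `γ · a` at `φ` is that of `a` at `φ ∘ σ`; this is also how `σ` acts on tensor
coordinates. Surjectivity of `ρ` comes from explicit loops `h diag(l) h⁻¹`. -/

theorem charpoly_eq (e : EigenBasis x) : x.charpoly = ∏ i, (X - C (e.val i)) := by
  have hx : Matrix.toEuclideanLin x = Matrix.toLin e.vec e.vec (Matrix.diagonal e.val) := by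
    refine e.vec.ext fun i => ?_
    simp [e.apply_vec, Matrix.toLin_self, Matrix.diagonal_apply]
  have hch : (Matrix.toEuclideanLin x).charpoly = x.charpoly := by
    rw [Matrix.toEuclideanLin_eq_toLin_orthonormal, Matrix.charpoly_toLin]
  rw [← hch, hx, Matrix.charpoly_toLin, Matrix.charpoly_diagonal]

theorem det_scalar_sub (e : EigenBasis x) (z : ℂ) :
    (Matrix.scalar (Fin d) z - x).det = ∏ i, (z - e.val i) := by
  rw [← Matrix.eval_charpoly, e.charpoly_eq, eval_prod]
  simp

theorem val_injective (e : EigenBasis x) (hx : IsRegularSemisimple x) :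
    Function.Injective e.val := by
  rw [isRegularSemisimple_iff, e.charpoly_eq] at hx
  exact separable_prod_X_sub_C_iff.1 hx

theorem hasEigenvector (e : EigenBasis x) (i : Fin d) :
    Module.End.HasEigenvector (Matrix.toEuclideanLin x) (e.val i) (e.vec i) :=
  ⟨Module.End.mem_eigenspace_iff.2 (e.apply_vec i), e.vec.ne_zero i⟩

theorem hasEigenvalue_iff (e : EigenBasis x) (z : ℂ) :
    Module.End.HasEigenvalue (Matrix.toEuclideanLin x) z ↔ ∃ i, e.val i = z := by
  have hch : (Matrix.toEuclideanLin x).charpoly = x.charpoly := by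
    rw [Matrix.toEuclideanLin_eq_toLin_orthonormal, Matrix.charpoly_toLin]
  rw [Module.End.hasEigenvalue_iff_isRoot_charpoly, hch, e.charpoly_eq, IsRoot, eval_prod,
    Finset.prod_eq_zero_iff]
  simp [sub_eq_zero, eq_comm (a := z)]

/-- An eigenbasis with prescribed pairwise distinct eigenvalues. -/
theorem exists_val_eq {l : Fin d → ℂ} (hl : Function.Injective l)
    (hev : ∀ i, Module.End.HasEigenvalue (Matrix.toEuclideanLin x) (l i)) :
    ∃ e : EigenBasis x, e.val = l := by
  choose v hv using fun i => (hev i).exists_hasEigenvector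
  have hli := Module.End.eigenvectors_linearIndependent' _ l hl v hv
  refine ⟨⟨basisOfLinearIndependentOfCardEqFinrank' v hli (by simp), l, fun i => ?_⟩, rfl⟩
  simpa using (hv i).apply_eq_smul

/-- The same eigenbasis with another numbering. -/
def reindex (e : EigenBasis x) (σ : Equiv.Perm (Fin d)) : EigenBasis x where
  vec := e.vec.reindex σ.symm
  val := e.val ∘ σ
  apply_vec i := by simp [e.apply_vec]

theorem flagOfMap_reindex (e : EigenBasis x) (σ : Equiv.Perm (Fin d)) (φ : Fin d → Fin n) :
    flagOfMap (e.reindex σ).vec φ = flagOfMap e.vec (φ ∘ σ.symm) := by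
  ext1
  funext j
  refine congrArg (Submodule.span ℂ) ?_
  ext v
  simp only [Set.mem_image, Set.mem_ofPred_eq, reindex, Module.Basis.reindex_apply,
    Equiv.symm_symm, Function.comp_apply]
  constructor
  · rintro ⟨i, hi, rfl⟩
    exact ⟨σ i, by simpa using hi, rfl⟩
  · rintro ⟨i, hi, rfl⟩
    exact ⟨σ.symm i, hi, by simp⟩

end EigenBasis

/-! ### Spectral projectors -/

/-- The polynomial taking the value `1` at the nodes `l i`, `i ∈ S`, and `0` at the others. -/
def indicatorPoly {d : ℕ} (l : Fin d → ℂ) (S : Finset (Fin d)) : ℂ[X] :=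
  Lagrange.interpolate Finset.univ l (fun i => if i ∈ S then 1 else 0)

/-- The spectral projector of `x` attached to a set of eigenvalues. -/
def spectralProj {d : ℕ} (x : gl d) (l : Fin d → ℂ) (S : Finset (Fin d)) : Cd d →L[ℂ] Cd d :=
  aeval (Matrix.toEuclideanCLM (𝕜 := ℂ) x) (indicatorPoly l S)

theorem aeval_toEuclideanCLM_apply {d : ℕ} (x : gl d) (p : ℂ[X]) (v : Cd d) :
    aeval (Matrix.toEuclideanCLM (𝕜 := ℂ) x) p v = aeval (Matrix.toEuclideanLin x) p v := by
  induction p using Polynomial.induction_on' generalizing v with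
  | add p q hp hq => simp [hp, hq]
  | monomial k a =>
    simp only [aeval_monomial, Algebra.algebraMap_eq_smul_one, smul_mul_assoc, one_mul,
      _root_.smul_apply, LinearMap.smul_apply]
    congr 1
    induction k generalizing v with
    | zero => simp
    | succ k ih =>
      rw [pow_succ, pow_succ]
      exact ih _

theorem aeval_mem_of_stable {d : ℕ} {x : gl d} {W : Submodule ℂ (Cd d)}
    (hW : ∀ v ∈ W, Matrix.toEuclideanLin x v ∈ W) (p : ℂ[X]) {v : Cd d} (hv : v ∈ W) :
    aeval (Matrix.toEuclideanLin x) p v ∈ W := by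
  induction p using Polynomial.induction_on' generalizing v with
  | add p q hp hq => simpa using W.add_mem (hp hv) (hq hv)
  | monomial k a =>
    simp only [aeval_monomial, Algebra.algebraMap_eq_smul_one, smul_mul_assoc, one_mul,
      LinearMap.smul_apply]
    refine W.smul_mem _ ?_
    induction k generalizing v with
    | zero => simpa using hv
    | succ k ih =>
      rw [pow_succ]
      exact ih (hW _ hv)

theorem spectralProj_vec {d : ℕ} {x : gl d} (e : EigenBasis x) (he : Function.Injective e.val)
    (S : Finset (Fin d)) (i : Fin d) :
    spectralProj x e.val S (e.vec i) = if i ∈ S then e.vec i else 0 := by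
  rw [spectralProj, aeval_toEuclideanCLM_apply,
    Module.End.aeval_apply_of_hasEigenvector (e.hasEigenvector i), indicatorPoly,
    Lagrange.eval_interpolate_at_node _ he.injOn (Finset.mem_univ i)]
  split_ifs <;> simp

/-- The only denominators in Lagrange interpolation are differences of distinct nodes, which do not
vanish. -/
theorem continuous_spectralProj {d : ℕ} {T : Type*} [TopologicalSpace T] {x : T → gl d}
    {l : T → Fin d → ℂ} (hx : Continuous x) (hl : Continuous l)
    (hinj : ∀ t, Function.Injective (l t)) (S : Finset (Fin d)) :
    Continuous fun t => spectralProj (x t) (l t) S := by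
  have hX : Continuous fun t => Matrix.toEuclideanCLM (𝕜 := ℂ) (x t) := by
    have : Continuous (Matrix.toEuclideanCLM (𝕜 := ℂ) (n := Fin d)).toAlgEquiv.toLinearMap :=
      LinearMap.continuous_of_finiteDimensional _
    exact this.comp hx
  have hli : ∀ i, Continuous fun t => l t i := fun i => (continuous_apply i).comp hl
  simp only [spectralProj, indicatorPoly, Lagrange.interpolate_apply, map_sum, map_mul, aeval_C]
  refine continuous_finsetSum _ fun i _ => continuous_const.mul ?_
  simp only [Lagrange.basis]
  -- Induction on the set of nodes needs an arbitrary finite set; only `i ∉ s` has to be remembered.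
  generalize hs : Finset.univ.erase i = s
  replace hs : i ∉ s := by simp [← hs]
  induction s using Finset.induction_on with
  | empty => simpa using continuous_const
  | insert j s hj ih =>
    simp only [Finset.mem_insert, not_or] at hs
    simp only [Finset.prod_insert hj, map_mul, Lagrange.basisDivisor, aeval_C, map_sub, aeval_X,
      Algebra.algebraMap_eq_smul_one]
    have h1 : Continuous fun t => (l t i - l t j)⁻¹ :=
      ((hli i).sub (hli j)).inv₀ fun t => sub_ne_zero.2 ((hinj t).ne hs.1)
    exact ((h1.smul continuous_const).mul (hX.sub ((hli j).smul continuous_const))).mul (ih hs.2)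

/-! ### Orthogonal projections onto ranges of idempotents -/

section Idempotent

variable {E : Type*} [NormedAddCommGroup E] [InnerProductSpace ℂ E] [FiniteDimensional ℂ E]

open ContinuousLinearMap

/-- The square of this operator is `1 + A* A` with `A = Q* - Q`, which is positive definite. So the
operator is injective, hence invertible in finite dimension. -/
theorem isUnit_add_adjoint_sub_one [CompleteSpace E] {Q : E →L[ℂ] E} (hQ : Q * Q = Q) :
    IsUnit (Q + adjoint Q - 1) := by
  have hQ' : adjoint Q * adjoint Q = adjoint Q := by
    simpa [← star_eq_adjoint] using congrArg star hQ
  have hinj : Function.Injective (Q + adjoint Q - 1 : E →L[ℂ] E) := by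
    rw [injective_iff_map_eq_zero]
    intro v hv
    have h1 : (Q + adjoint Q - 1) * (Q + adjoint Q - 1)
        = 1 + adjoint (adjoint Q - Q) * (adjoint Q - Q) := by
      simp only [map_sub, adjoint_adjoint]
      simp only [mul_sub, sub_mul, add_mul, mul_add, hQ, hQ', mul_one, one_mul]
      abel
    have h2 : ((Q + adjoint Q - 1) * (Q + adjoint Q - 1)) v = 0 := by
      exact (congrArg (Q + adjoint Q - 1 : E →L[ℂ] E) hv).trans (map_zero _)
    rw [h1] at h2
    have h3 : inner ℂ ((1 + adjoint (adjoint Q - Q) * (adjoint Q - Q)) v) v = 0 := by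
      rw [h2, inner_zero_left]
    rw [_root_.add_apply, one_apply_eq_self, inner_add_left, mul_apply_eq_comp,
      adjoint_inner_left, inner_self_eq_norm_sq_to_K, inner_self_eq_norm_sq_to_K] at h3
    have h4 : ‖v‖ ^ 2 + ‖(adjoint Q - Q) v‖ ^ 2 = 0 :=
      Complex.ofReal_injective (by push_cast; exact h3)
    have h5 : ‖v‖ ^ 2 = 0 := by nlinarith [sq_nonneg ‖v‖, sq_nonneg ‖(adjoint Q - Q) v‖]
    simpa using h5
  rw [isUnit_iff_bijective]
  exact ⟨hinj, LinearMap.surjective_of_injective (f := (Q + adjoint Q - 1 : E →L[ℂ] E).toLinearMap)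
    hinj⟩

/-- Let `P` be the orthogonal projection. Since `P` and `Q` have the same range, `P Q = Q` and `Q P
= P`; the adjoint of the latter is `P Q* = P`. Therefore `P (Q + Q* - 1) = Q`. -/
theorem starProjection_eq_mul_inverse [CompleteSpace E] {Q : E →L[ℂ] E} (hQ : Q * Q = Q)
    (W : Submodule ℂ E) (hW : ∀ v, v ∈ W ↔ Q v = v) :
    W.starProjection = Q * Ring.inverse (Q + adjoint Q - 1) := by
  have hQP : Q * W.starProjection = W.starProjection := by
    ext v
    exact (hW _).1 (W.starProjection_apply_mem v)
  have hPQ : W.starProjection * Q = Q := by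
    ext v
    exact Submodule.starProjection_eq_self_iff.2 ((hW _).2 (congrArg (fun A : E →L[ℂ] E => A v) hQ))
  have hP : adjoint W.starProjection = W.starProjection :=
    (isSelfAdjoint_starProjection W)
  have hPQ' : W.starProjection * adjoint Q = W.starProjection := by
    have := congrArg star hQP
    rw [star_mul, star_eq_adjoint, star_eq_adjoint, hP] at this
    exact this
  have h : W.starProjection * (Q + adjoint Q - 1) = Q := by
    rw [mul_sub, mul_add, hPQ, hPQ', mul_one, add_sub_cancel_right]
  nth_rewrite 1 [← h]
  rw [mul_assoc, Ring.mul_inverse_cancel _ (isUnit_add_adjoint_sub_one hQ), mul_one]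

theorem continuous_starProjection [CompleteSpace E] {T : Type*} [TopologicalSpace T]
    {Q : T → E →L[ℂ] E} {W : T → Submodule ℂ E} (hQc : Continuous Q) (hQ : ∀ t, Q t * Q t = Q t)
    (hW : ∀ t v, v ∈ W t ↔ Q t v = v) : Continuous fun t => (W t).starProjection := by
  have : (fun t => (W t).starProjection)
      = fun t => Q t * Ring.inverse (Q t + adjoint (Q t) - 1) :=
    funext fun t => starProjection_eq_mul_inverse (hQ t) _ (hW t)
  rw [this]
  refine hQc.mul (continuous_iff_continuousAt.2 fun t => ?_)
  obtain ⟨u, hu⟩ := isUnit_add_adjoint_sub_one (hQ t)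
  have h1 := NormedRing.inverse_continuousAt u
  rw [hu] at h1
  have h2 : Continuous fun t => Q t + adjoint (Q t) - 1 :=
    (hQc.add ((adjoint (𝕜 := ℂ) (E := E) (F := E)).continuous.comp hQc)).sub continuous_const
  exact ContinuousAt.comp (f := fun t => Q t + adjoint (Q t) - 1) h1 h2.continuousAt

end Idempotent

/-! ### Flags attached to eigenbases -/

section Flags

variable {n d : ℕ}

theorem spectralProj_mul_self {x : gl d} (e : EigenBasis x) (he : Function.Injective e.val)
    (S : Finset (Fin d)) :
    spectralProj x e.val S * spectralProj x e.val S = spectralProj x e.val S := by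
  refine ContinuousLinearMap.coe_injective (e.vec.ext fun i => ?_)
  simp only [ContinuousLinearMap.coe_coe, mul_apply_eq_comp, spectralProj_vec e he]
  split_ifs with h <;> simp [spectralProj_vec e he, h]

theorem mem_span_iff_spectralProj {x : gl d} (e : EigenBasis x) (he : Function.Injective e.val)
    (S : Finset (Fin d)) (v : Cd d) :
    v ∈ Submodule.span ℂ (e.vec '' S) ↔ spectralProj x e.val S v = v := by
  constructor
  · intro hv
    induction hv using Submodule.span_induction with
    | mem v hv =>
      obtain ⟨i, hi, rfl⟩ := hv
      rw [spectralProj_vec e he, if_pos (by simpa using hi)]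
    | zero => simp
    | add v w _ _ hv hw => rw [map_add, hv, hw]
    | smul c v _ hv => rw [map_smul, hv]
  · intro hv
    rw [← hv, ← e.vec.sum_repr v, map_sum]
    refine Submodule.sum_mem _ fun i _ => ?_
    rw [map_smul, spectralProj_vec e he]
    split_ifs with h
    · exact Submodule.smul_mem _ _ (Submodule.subset_span ⟨i, h, rfl⟩)
    · simp

theorem mem_flagOfMap_space_iff {x : gl d} (e : EigenBasis x) (he : Function.Injective e.val)
    (φ : Fin d → Fin n) (j : Fin (n + 1)) (v : Cd d) :
    v ∈ (flagOfMap e.vec φ).space j ↔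
      spectralProj x e.val (Finset.univ.filter fun i => (φ i).castSucc < j) v = v := by
  rw [← mem_span_iff_spectralProj e he]
  simp [flagOfMap]

/-- The flags attached to an eigenbasis depend only on the numbering of the eigenvalues. -/
theorem flagOfMap_eq_of_val_eq {x : gl d} (e e' : EigenBasis x) (he : Function.Injective e.val)
    (h : e'.val = e.val) (φ : Fin d → Fin n) : flagOfMap e'.vec φ = flagOfMap e.vec φ := by
  ext j v
  rw [mem_flagOfMap_space_iff e he, mem_flagOfMap_space_iff e' (h ▸ he), h]

theorem fiberPoint_eq_of_val_eq {x : gl d} (e e' : EigenBasis x) (he : Function.Injective e.val)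
    (h : e'.val = e.val) (φ : Fin d → Fin n) : e'.fiberPoint φ = e.fiberPoint φ :=
  Subtype.ext (congrArg (Prod.mk x) (flagOfMap_eq_of_val_eq e e' he h φ))

theorem continuous_fiberPoint {T : Type*} [TopologicalSpace T] {x : T → gl d} (hx : Continuous x)
    (e : ∀ t, EigenBasis (x t)) (he : ∀ t, Function.Injective (e t).val)
    (hc : Continuous fun t => (e t).val) (φ : Fin d → Fin n) :
    Continuous fun t => (e t).fiberPoint φ := by
  refine Continuous.subtype_mk (hx.prodMk ?_) _
  refine continuous_induced_rng.2 (continuous_pi fun j => ?_)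
  exact continuous_starProjection
    (continuous_spectralProj hx hc he (Finset.univ.filter fun i => (φ i).castSucc < j))
    (fun t => spectralProj_mul_self (e t) (he t) _)
    (fun t v => mem_flagOfMap_space_iff (e t) (he t) φ j v)

instance : T2Space (PartialFlag n d) := by
  refine T2Space.of_injective_continuous
    (f := fun (F : PartialFlag n d) j => (F.space j).starProjection) ?_ continuous_induced_dom
  intro F G h
  ext1
  funext j
  exact Submodule.starProjection_inj.1 (congrFun h j)

/-- The value `φ i` records the step at which the eigenvector `e_i` enters the flag. Each `F_j` is
spanned by the eigenvectors in it because it is stable under the spectral projectors, which are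
polynomials in `x`. -/
theorem exists_flagOfMap_eq {x : gl d} (e : EigenBasis x) (he : Function.Injective e.val)
    (F : PartialFlag n d)
    (hF : ∀ j, ∀ v ∈ F.space j, Matrix.toEuclideanLin x v ∈ F.space j) :
    ∃ φ : Fin d → Fin n, flagOfMap e.vec φ = F := by
  have hφ : ∀ i, ∃ k : Fin n, ∀ j, e.vec i ∈ F.space j ↔ k.castSucc < j := by
    intro i
    have hex : ∃ j, e.vec i ∈ F.space j := ⟨Fin.last n, by rw [F.last_eq]; trivial⟩
    obtain ⟨m, hm⟩ := (Set.toFinite {j | e.vec i ∈ F.space j}).exists_minimal hex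
    -- Since `F_0 = 0`, the first index is a successor `k + 1`; with values numbered from `0`, `φ i`
    -- is `k`.
    have hm0 : m ≠ 0 := by
      rintro rfl
      have := hm.1
      simp only [Set.mem_ofPred_eq, F.zero_eq, Submodule.mem_bot] at this
      exact e.vec.ne_zero i this
    obtain ⟨k, rfl⟩ := Fin.exists_succ_eq.2 hm0
    refine ⟨k, fun j => ?_⟩
    rw [Fin.castSucc_lt_iff_succ_le]
    refine ⟨fun hj => ?_, fun hj => F.mono hj hm.1⟩
    rcases le_total k.succ j with h | h
    · exact h
    · exact hm.2 hj h
  choose φ hφ using hφ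
  refine ⟨φ, ?_⟩
  ext j v
  constructor
  · intro hv
    refine (Submodule.span_le (p := F.space j)).2 ?_ hv
    rintro _ ⟨i, hi, rfl⟩
    exact (hφ i j).2 hi
  · intro hv
    rw [← e.vec.sum_repr v]
    refine Submodule.sum_mem _ fun i _ => ?_
    by_cases hi : e.vec.repr v i = 0
    · simp [hi]
    refine Submodule.smul_mem _ _ ((mem_flagOfMap_iff _ _ _ _).2 ((hφ i j).1 ?_))
    -- The projector onto the `i`-th eigenline sends `v` to its `i`-th component, so a nonzero
    -- component forces `e_i` into `F_j`.
    have h1 : spectralProj x e.val {i} v ∈ F.space j := by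
      rw [spectralProj, aeval_toEuclideanCLM_apply]
      exact aeval_mem_of_stable (hF j) _ hv
    have h2 : spectralProj x e.val {i} v = e.vec.repr v i • e.vec i := by
      conv_lhs => rw [← e.vec.sum_repr v]
      rw [map_sum]
      simp only [map_smul, spectralProj_vec e he, Finset.mem_singleton, smul_ite, smul_zero]
      simp
    rw [h2] at h1
    exact (Submodule.smul_mem_iff _ hi).1 h1

theorem exists_fiberPoint_eq {x : gl d} (e : EigenBasis x) (he : Function.Injective e.val)
    (F : Mperp n d) (hF : F.1.1 = x) : ∃ φ : Fin d → Fin n, e.fiberPoint φ = F := by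
  obtain ⟨⟨y, F⟩, hst⟩ := F
  obtain rfl : y = x := hF
  obtain ⟨φ, rfl⟩ := exists_flagOfMap_eq e he F hst
  exact ⟨φ, rfl⟩

theorem fiberPoint_injective {x : gl d} (e : EigenBasis x) :
    Function.Injective (e.fiberPoint : (Fin d → Fin n) → Mperp n d) := by
  intro φ ψ h
  have h' : flagOfMap e.vec φ = flagOfMap e.vec ψ := congrArg (fun p : Mperp n d => p.1.2) h
  funext i
  have key : ∀ j : Fin (n + 1), (φ i).castSucc < j ↔ (ψ i).castSucc < j := fun j => by
    rw [← mem_flagOfMap_iff e.vec φ, ← mem_flagOfMap_iff e.vec ψ, h']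
  have h1 := (key (φ i).succ).1 Fin.castSucc_lt_succ
  have h2 := (key (ψ i).succ).2 Fin.castSucc_lt_succ
  rw [Fin.castSucc_lt_succ_iff] at h1 h2
  exact le_antisymm h2 h1

end Flags

/-! ### Finite families of sections -/

/-- If finitely many pairwise disjoint sections of a map from a Hausdorff space exhaust its source,
then the number of the section through a point is locally constant. -/
theorem isLocallyConstant_of_sections {Z B ι : Type*} [TopologicalSpace Z] [TopologicalSpace B]
    [T2Space Z] [Finite ι] {q : Z → B} (hq : Continuous q) {s : ι → B → Z}
    (hs : ∀ i, Continuous (s i)) (hinj : ∀ b, Function.Injective fun i => s i b) {label : Z → ι}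
    (hl : ∀ z, s (label z) (q z) = z) : IsLocallyConstant label := by
  have hiff : ∀ i z, label z = i ↔ s i (q z) = z := fun i z =>
    ⟨fun h => h ▸ hl z, fun h => hinj (q z) ((hl z).trans h.symm)⟩
  have hc : ∀ i, IsClosed (label ⁻¹' {i}) := fun i => by
    have : label ⁻¹' {i} = {z | s i (q z) = z} := Set.ext fun z => hiff i z
    rw [this]
    exact isClosed_eq ((hs i).comp hq) continuous_id
  rw [IsLocallyConstant.iff_isOpen_fiber]
  intro i
  -- Each label class is closed, as the coincidence set of two continuous maps into a Hausdorff
  -- space; with finitely many classes, each is also open.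
  have : label ⁻¹' {i} = (⋃ j ∈ {j | j ≠ i}, label ⁻¹' {j})ᶜ := by
    ext z
    simp only [Set.mem_preimage, Set.mem_singleton_iff, Set.mem_compl_iff, Set.mem_iUnion,
      Set.mem_ofPred_eq, exists_prop, not_exists, not_and]
    exact ⟨fun h j hj hz => hj (hz.symm.trans h), fun h => by_contra fun hz => h _ hz rfl⟩
  change IsOpen (label ⁻¹' {i})
  rw [this, isOpen_compl_iff]
  exact (Set.toFinite _).isClosed_biUnion fun j _ => hc j

theorem isEvenlyCovered_of_sections {Z B ι : Type*} [TopologicalSpace Z] [TopologicalSpace B]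
    [T2Space Z] [Finite ι] [TopologicalSpace ι] [DiscreteTopology ι] {p : Z → B}
    (hp : Continuous p) {U : Set B} (hU : IsOpen U) {x : B} (hx : x ∈ U) {s : ι → U → Z}
    (hs : ∀ i, Continuous (s i)) (hps : ∀ i y, p (s i y) = y)
    (hinj : ∀ y, Function.Injective fun i => s i y)
    (hsurj : ∀ z (h : p z ∈ U), ∃ i, s i ⟨p z, h⟩ = z) : IsEvenlyCovered p x ι := by
  refine ⟨inferInstance, U, hx, hU, hU.preimage hp, ?_⟩
  choose label hlabel using fun z : p ⁻¹' U => hsurj z.1 z.2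
  let q : p ⁻¹' U → U := fun z => ⟨p z.1, z.2⟩
  have hq : Continuous q := (hp.comp continuous_subtype_val).subtype_mk _
  let s' : ι → U → p ⁻¹' U := fun i y => ⟨s i y, by
    rw [Set.mem_preimage, hps]
    exact y.2⟩
  have hs' : ∀ i, Continuous (s' i) := fun i => (hs i).subtype_mk _
  have hqs : ∀ i y, q (s' i y) = y := fun i y => Subtype.ext (hps i y)
  have hl : ∀ z, s' (label z) (q z) = z := fun z => Subtype.ext (hlabel z)
  have hinj' : ∀ y, Function.Injective fun i => s' i y := fun y i j h =>
    hinj y (congrArg Subtype.val h)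
  refine ⟨{ toFun := fun z => (q z, label z)
            invFun := fun a => s' a.2 a.1
            left_inv := hl
            right_inv := fun a => ?_
            continuous_toFun := ?_
            continuous_invFun := ?_ }, fun z => rfl⟩
  · refine Prod.ext (hqs _ _) (hinj' a.1 ?_)
    have := hl (s' a.2 a.1)
    rwa [hqs] at this
  · exact hq.prodMk (isLocallyConstant_of_sections hq hs' hinj' hl).continuous
  · exact continuous_prod_of_discrete_right.2 fun i => hs' i

/-! ### Local eigenvalue functions -/

section Eigenvalues

variable {d : ℕ}

/-- The modulus of the characteristic polynomial at `z` is the product of the distances from `z` to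
the eigenvalues. It is continuous in `y` and vanishes at `y₀`, whereas it would be at least `ε ^ d`
if all eigenvalues of `y` stayed `ε` away from `z`. -/
theorem eventually_exists_eigenvalue (y₀ : glrs d) {z : ℂ}
    (hz : Module.End.HasEigenvalue (Matrix.toEuclideanLin y₀.1) z) {ε : ℝ} (hε : 0 < ε) :
    ∀ᶠ y : glrs d in 𝓝 y₀, ∃ w, Module.End.HasEigenvalue (Matrix.toEuclideanLin y.1) w ∧
      dist w z < ε := by
  have hc : Continuous fun y : glrs d => ‖(Matrix.scalar (Fin d) z - y.1).det‖ :=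
    ((continuous_const.sub continuous_subtype_val).matrix_det).norm
  have h0 : ‖(Matrix.scalar (Fin d) z - y₀.1).det‖ < ε ^ d := by
    obtain ⟨e, -⟩ := y₀.2
    obtain ⟨i, hi⟩ := (e.hasEigenvalue_iff z).1 hz
    rw [e.det_scalar_sub, Finset.prod_eq_zero (Finset.mem_univ i) (by rw [hi, sub_self]), norm_zero]
    positivity
  filter_upwards [hc.continuousAt.eventually_lt continuousAt_const h0] with y hy
  obtain ⟨e, -⟩ := y.2
  by_contra! hcon
  refine absurd hy (not_lt.2 ?_)
  rw [e.det_scalar_sub, norm_prod]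
  calc ε ^ d = ∏ _i : Fin d, ε := by simp
    _ ≤ _ := Finset.prod_le_prod (fun _ _ => hε.le) fun i _ => by
      have := hcon _ ((e.hasEigenvalue_iff _).2 ⟨i, rfl⟩)
      rwa [dist_comm, dist_eq_norm] at this

/-- Near a regular semisimple matrix the eigenvalues can be numbered continuously. -/
theorem exists_local_eigenBasis (x : glrs d) (e : EigenBasis x.1) :
    ∃ (U : Opens (glrs d)) (hx : x ∈ U) (e' : ∀ y : U, EigenBasis y.1.1),
      (e' ⟨x, hx⟩).val = e.val ∧ Continuous fun y => (e' y).val := by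
  have he := e.val_injective x.2
  -- The discs of radius `ε` around the eigenvalues of `x` are disjoint. For `y` near `x` each
  -- contains an eigenvalue of `y`, and by counting exactly one.
  obtain ⟨ε, hε, hsep⟩ : ∃ ε > 0, ∀ i j, ∀ w, dist w (e.val i) < ε → dist w (e.val j) < ε →
      i = j := by
    have h1 : ∀ p : Fin d × Fin d, ∃ ε > 0, ∀ w, dist w (e.val p.1) < ε →
        dist w (e.val p.2) < ε → p.1 = p.2 := by
      intro p
      by_cases hp : p.1 = p.2
      · exact ⟨1, one_pos, fun _ _ _ => hp⟩
      · refine ⟨dist (e.val p.1) (e.val p.2) / 2, half_pos (dist_pos.2 (he.ne hp)), ?_⟩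
        intro w hw1 hw2
        have := dist_triangle_left (e.val p.1) (e.val p.2) w
        linarith
    choose ε hε h using h1
    obtain ⟨δ, hδ, hle⟩ : ∃ δ > 0, ∀ p, δ ≤ ε p := by
      have : ∀ᶠ δ in 𝓝[>] (0 : ℝ), ∀ p, δ ≤ ε p := by
        rw [Filter.eventually_all]
        intro p
        exact nhdsWithin_le_nhds (Iic_mem_nhds (hε p))
      obtain ⟨δ, h1, h2⟩ := (this.and self_mem_nhdsWithin).exists
      exact ⟨δ, h2, h1⟩
    exact ⟨δ, hδ, fun i j w h1 h2 => h (i, j) w (h1.trans_le (hle _)) (h2.trans_le (hle _))⟩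
  have hev : ∀ᶠ y : glrs d in 𝓝 x, ∀ i, ∃ w,
      Module.End.HasEigenvalue (Matrix.toEuclideanLin y.1) w ∧ dist w (e.val i) < ε :=
    Filter.eventually_all.2 fun i =>
      eventually_exists_eigenvalue x ((e.hasEigenvalue_iff _).2 ⟨i, rfl⟩) hε
  obtain ⟨U, hU, hUo, hxU⟩ := eventually_nhds_iff.1 hev
  choose l hl hlε using hU
  have hinj : ∀ y hy, Function.Injective (l y hy) := fun y hy i j hij =>
    hsep i j (l y hy i) (hlε y hy i) (hij ▸ hlε y hy j)
  choose e' he' using fun y : U => EigenBasis.exists_val_eq (hinj y.1 y.2) (hl y.1 y.2)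
  have huniq : ∀ (y : U) (w : ℂ) (i : Fin d),
      Module.End.HasEigenvalue (Matrix.toEuclideanLin y.1.1) w → dist w (e.val i) < ε →
      w = (e' y).val i := by
    intro y w i hw hwi
    obtain ⟨j, rfl⟩ := ((e' y).hasEigenvalue_iff w).1 hw
    have : dist ((e' y).val j) (e.val j) < ε := he' y ▸ hlε y.1 y.2 j
    rw [hsep j i _ this hwi]
  refine ⟨⟨U, hUo⟩, hxU, e', ?_, ?_⟩
  · funext i
    exact (huniq ⟨x, hxU⟩ _ i ((e.hasEigenvalue_iff _).2 ⟨i, rfl⟩) (by simpa using hε)).symm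
  · refine continuous_pi fun i => continuous_iff_continuousAt.2 fun y₀ => ?_
    rw [Metric.continuousAt_iff']
    intro δ hδ
    have hy₀ : dist ((e' y₀).val i) (e.val i) < ε := he' y₀ ▸ hlε y₀.1 y₀.2 i
    -- The second bound keeps the nearby eigenvalue inside the `i`-th disc, where `huniq` identifies
    -- it as the `i`-th one.
    have := eventually_exists_eigenvalue y₀.1 (((e' y₀).hasEigenvalue_iff _).2 ⟨i, rfl⟩)
      (lt_min hδ (sub_pos.2 hy₀))
    filter_upwards [continuous_subtype_val.continuousAt.eventually this]
    rintro y ⟨w, hw, hd⟩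
    rw [lt_min_iff] at hd
    rw [← huniq y w i hw]
    · exact hd.1
    · have := dist_triangle w ((e' y₀).val i) (e.val i)
      linarith [hd.2]

/-! ### The covering by eigenvalues -/

/-- Pairs of a regular semisimple matrix and one of its eigenvalues. -/
abbrev EigenvalueCover (d : ℕ) : Type :=
  {p : glrs d × ℂ // Module.End.HasEigenvalue (Matrix.toEuclideanLin p.1.1) p.2}

/-- The projection `(x, z) ↦ x`. -/
def EigenvalueCover.proj (p : EigenvalueCover d) : glrs d := p.1.1

theorem EigenvalueCover.isCoveringMap_proj :
    IsCoveringMap (EigenvalueCover.proj : EigenvalueCover d → glrs d) := by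
  intro x
  obtain ⟨e, -⟩ := x.2
  obtain ⟨U, hxU, e', -, hc⟩ := exists_local_eigenBasis x e
  refine IsEvenlyCovered.to_isEvenlyCovered_preimage (I := Fin d) ?_
  refine isEvenlyCovered_of_sections (continuous_fst.comp continuous_subtype_val) U.isOpen hxU
    (s := fun i y => ⟨(y.1, (e' y).val i), ((e' y).hasEigenvalue_iff _).2 ⟨i, rfl⟩⟩) ?_ ?_ ?_ ?_
  · exact fun i => (continuous_subtype_val.prodMk ((continuous_apply i).comp hc)).subtype_mk _
  · exact fun i y => rfl
  · intro y i j h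
    exact (e' y).val_injective y.1.2 (congrArg (fun p : EigenvalueCover d => p.1.2) h)
  · rintro ⟨⟨y, w⟩, hw⟩ hy
    obtain ⟨i, hi⟩ := ((e' ⟨y, hy⟩).hasEigenvalue_iff w).1 hw
    exact ⟨i, Subtype.ext (Prod.ext rfl hi)⟩

/-- The fibre of the covering by eigenvalues, numbered by an eigenbasis. -/
def EigenBasis.fiberEquiv {x : glrs d} (e : EigenBasis x.1) :
    Fin d ≃ (EigenvalueCover.proj : EigenvalueCover d → glrs d) ⁻¹' {x} :=
  Equiv.ofBijective
    (fun i => ⟨⟨(x, e.val i), (e.hasEigenvalue_iff _).2 ⟨i, rfl⟩⟩, rfl⟩) <| by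
  constructor
  · intro i j h
    exact e.val_injective x.2 (congrArg (fun p => p.1.1.2) h)
  · rintro ⟨⟨⟨y, w⟩, hw⟩, hy⟩
    obtain rfl : y = x := hy
    obtain ⟨i, rfl⟩ := (e.hasEigenvalue_iff w).1 hw
    exact ⟨i, rfl⟩

/-- The permutation of the eigenvalues of `x` along loops at `x`. -/
def EigenBasis.permHom {x : glrs d} (e : EigenBasis x.1) :
    FundamentalGroup (glrs d) x →* Equiv.Perm (Fin d) :=
  e.fiberEquiv.symm.permCongrHom.toMonoidHom.comp
    (EigenvalueCover.isCoveringMap_proj.monodromyPerm x)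

/-- Along a path the eigenvalues can be numbered continuously. -/
theorem exists_eigenBasis_path {x y : glrs d} (γ : Path x y) (e : EigenBasis x.1) :
    ∃ e' : ∀ t, EigenBasis (γ t).1, (e' 0).val = e.val ∧ Continuous fun t => (e' t).val := by
  have cov := EigenvalueCover.isCoveringMap_proj (d := d)
  choose Γ hΓ hΓ0 using fun i => cov.exists_path_lifts γ.toContinuousMap (e.fiberEquiv i).1
    (γ.source.trans (e.fiberEquiv i).2.symm)
  have hΓ' : ∀ i t, ((Γ i t).1.1 : glrs d) = γ t := fun i t => congrFun (hΓ i) t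
  have hinj : ∀ t, Function.Injective fun i => (Γ i t).1.2 := by
    intro t i j hij
    have h1 : Γ i t = Γ j t := Subtype.ext (Prod.ext ((hΓ' i t).trans (hΓ' j t).symm) hij)
    -- Two lifts that meet at some time coincide throughout, contradicting distinct starting points
    -- unless `i = j`.
    have h2 := cov.eq_of_comp_eq (Γ i).continuous (Γ j).continuous
      ((hΓ i).trans (hΓ j).symm) t h1
    have h3 := congrFun h2 0
    rw [hΓ0, hΓ0] at h3
    exact e.fiberEquiv.injective (Subtype.ext h3)
  choose e' he' using fun t => EigenBasis.exists_val_eq (x := (γ t).1) (hinj t)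
    (fun i => hΓ' i t ▸ (Γ i t).2)
  refine ⟨e', ?_, ?_⟩
  · rw [he']
    funext i
    rw [hΓ0]
    rfl
  · simp only [he']
    exact continuous_pi fun i =>
      continuous_snd.comp (continuous_subtype_val.comp (Γ i).continuous)

/-- The characterization of `permHom` by continuous families of eigenvalues. -/
theorem EigenBasis.val_permHom {x : glrs d} (e : EigenBasis x.1) (γ : Path x x)
    {l : unitInterval → ℂ} (hl : Continuous l)
    (hev : ∀ t, Module.End.HasEigenvalue (Matrix.toEuclideanLin (γ t).1) (l t)) {i : Fin d}
    (h0 : l 0 = e.val i) :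
    e.val (e.permHom (FundamentalGroup.fromPath (Path.Homotopic.Quotient.mk γ)) i) = l 1 := by
  have cov := EigenvalueCover.isCoveringMap_proj (d := d)
  let p0 : EigenvalueCover d := ⟨(x, l 0), by simpa using hev 0⟩
  let p1 : EigenvalueCover d := ⟨(x, l 1), by simpa using hev 1⟩
  -- The pair `(γ, l)` is itself a lift of `γ` to the covering, so its end point computes the
  -- monodromy.
  let Γ : Path p0 p1 :=
    { toFun := fun t => ⟨(γ t, l t), hev t⟩
      continuous_toFun := (γ.continuous.prodMk hl).subtype_mk _
      source' := Subtype.ext (Prod.ext γ.source rfl)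
      target' := Subtype.ext (Prod.ext γ.target rfl) }
  have hm := cov.monodromy_map (Path.Homotopic.Quotient.mk Γ)
  have hfi : e.fiberEquiv i = ⟨p0, rfl⟩ :=
    Subtype.ext (Subtype.ext (Prod.ext rfl h0.symm))
  have key : e.fiberEquiv (e.permHom (FundamentalGroup.fromPath (Path.Homotopic.Quotient.mk γ)) i)
      = ⟨p1, rfl⟩ := by
    change e.fiberEquiv (e.fiberEquiv.symm (cov.monodromy (Path.Homotopic.Quotient.mk γ)
      (e.fiberEquiv i))) = _
    rw [Equiv.apply_symm_apply, hfi]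
    exact hm
  exact congrArg (fun p => p.1.1.2) key

end Eigenvalues

/-! ### Sections of the direct image -/

section Sections

variable {n d : ℕ}

/-- The preimage under `muTilde` of an open set of regular semisimple matrices. -/
abbrev fiberDomain (n : ℕ) {d : ℕ} (U : Opens (glrs d)) : Type :=
  {F : Mperp n d // ∃ y : glrs d, y ∈ U ∧ y.1 = F.1.1}

/-- The base point of a point of `fiberDomain`. -/
def fiberDomain.base {U : Opens (glrs d)} (F : fiberDomain n U) : U :=
  ⟨⟨F.1.1.1, by obtain ⟨y, -, h⟩ := F.2; exact h ▸ y.2⟩, by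
    obtain ⟨y, hy, h⟩ := F.2
    have : y = ⟨F.1.1.1, h ▸ y.2⟩ := Subtype.ext h
    exact this ▸ hy⟩

theorem fiberDomain.continuous_base {U : Opens (glrs d)} :
    Continuous (fiberDomain.base : fiberDomain n U → U) :=
  ((continuous_fst.comp (continuous_subtype_val.comp continuous_subtype_val)).subtype_mk
    _).subtype_mk _

/-- The section given by a locally constant function. -/
def sectionOf {U : Opens (glrs d)} (f : LocallyConstant (fiberDomain n U) ℂ) :
    (muTildeSheafRS n d).presheaf.obj (op (U : Opens (TopCat.of (glrs d)))) := f

theorem section_ext {U : Opens (TopCat.of (glrs d))}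
    {s t : (muTildeSheafRS n d).presheaf.obj (op U)}
    (h : ∀ (x : glrs d) (hx : x ∈ U) (F : Mperp n d) (hF : F.1.1 = x.1),
      evalAt s x hx F hF = evalAt t x hx F hF) : s = t := by
  refine LocallyConstant.ext (X := fiberDomain n U) (Y := ℂ) fun F => ?_
  obtain ⟨F, y, hy, hF⟩ := F
  exact h y hy F hF.symm

theorem isLocallyConstant_evalAt {U : Opens (TopCat.of (glrs d))}
    (s : (muTildeSheafRS n d).presheaf.obj (op U)) {T : Type*} [TopologicalSpace T]
    {p : T → Mperp n d} (hp : Continuous p) {y : T → glrs d} (hy : ∀ t, y t ∈ U)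
    (h : ∀ t, (p t).1.1 = (y t).1) : IsLocallyConstant fun t => evalAt s (y t) (hy t) (p t) (h t) :=
  IsLocallyConstant.comp_continuous
    (f := fun t => (⟨p t, ⟨y t, hy t, (h t).symm⟩⟩ : fiberDomain n U))
    (LocallyConstant.isLocallyConstant (show LocallyConstant (fiberDomain n U) ℂ from s))
    (hp.subtype_mk _)

/-- Evaluation of sections, as a linear map. -/
def evalAtₗ (U : Opens (TopCat.of (glrs d))) (x : glrs d) (hx : x ∈ U) (F : Mperp n d)
    (hF : F.1.1 = x.1) : (muTildeSheafRS n d).presheaf.obj (op U) →ₗ[ℂ] ℂ where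
  toFun s := evalAt s x hx F hF
  map_add' _ _ := rfl
  map_smul' _ _ := rfl

/-- Evaluation of germs at a point of the fibre. -/
def evalStalk (x : TopCat.of (glrs d)) (F : Mperp n d) (hF : F.1.1 = x.1) :
    (muTildeSheafRS n d).presheaf.stalk x →ₗ[ℂ] ℂ :=
  ModuleCat.Hom.hom
    (Limits.colimit.desc ((OpenNhds.inclusion x).op ⋙ (muTildeSheafRS n d).presheaf)
      { pt := ModuleCat.of ℂ ℂ
        ι :=
          { app := fun U => ModuleCat.ofHom (evalAtₗ U.unop.1 x U.unop.2 F hF)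
            naturality := fun U V i => by
              ext s
              rfl } })

theorem evalStalk_germ (x : TopCat.of (glrs d)) (F : Mperp n d) (hF : F.1.1 = x.1)
    (U : Opens (TopCat.of (glrs d))) (hx : x ∈ U)
    (s : (muTildeSheafRS n d).presheaf.obj (op U)) :
    evalStalk x F hF ((muTildeSheafRS n d).presheaf.germ U x hx s) = evalAt s x hx F hF := by
  have := Limits.colimit.ι_desc (F := (OpenNhds.inclusion x).op ⋙ (muTildeSheafRS n d).presheaf)
      { pt := ModuleCat.of ℂ ℂ
        ι :=
          { app := fun U => ModuleCat.ofHom (evalAtₗ (n := n) U.unop.1 x U.unop.2 F hF)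
            naturality := fun U V i => by
              ext s
              rfl } } (op ⟨U, hx⟩)
  exact ConcreteCategory.congr_hom this s

end Sections

/-! ### Local triviality -/

section LocalTriviality

variable {n d : ℕ} {U : Opens (glrs d)}

/-- Given a continuous numbering of the eigenvalues over `U`, the points of the fibres over `U`
are numbered by a locally constant function. -/
theorem exists_label (n : ℕ) (e : ∀ y : U, EigenBasis y.1.1) (hc : Continuous fun y => (e y).val) :
    ∃ label : LocallyConstant (fiberDomain n U) (Fin d → Fin n),
      ∀ F, (e F.base).fiberPoint (label F) = F.1 := by
  choose label hl using fun F : fiberDomain n U =>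
    exists_fiberPoint_eq (e F.base) ((e F.base).val_injective F.base.1.2) F.1 rfl
  refine ⟨⟨label, ?_⟩, hl⟩
  refine isLocallyConstant_of_sections fiberDomain.continuous_base
    (s := fun φ y => ⟨(e y).fiberPoint φ, y.1, y.2, rfl⟩) (fun φ => ?_) (fun y φ ψ h => ?_)
    (fun F => Subtype.ext (hl F))
  · exact (continuous_fiberPoint (continuous_subtype_val.comp continuous_subtype_val) e
      (fun y => (e y).val_injective y.1.2) hc φ).subtype_mk _
  · exact fiberPoint_injective (e y) (congrArg Subtype.val h)

theorem label_fiberPoint {e : ∀ y : U, EigenBasis y.1.1}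
    {label : LocallyConstant (fiberDomain n U) (Fin d → Fin n)}
    (hl : ∀ F, (e F.base).fiberPoint (label F) = F.1) (y : U) (φ : Fin d → Fin n)
    (h : ∃ z : glrs d, z ∈ U ∧ z.1 = ((e y).fiberPoint φ).1.1) :
    label ⟨(e y).fiberPoint φ, h⟩ = φ :=
  fiberPoint_injective (e y) (hl ⟨(e y).fiberPoint φ, h⟩)

theorem isLocallyConstant_pi {T ι β : Type*} [TopologicalSpace T] [Finite ι] {f : T → ι → β}
    (h : ∀ i, IsLocallyConstant fun t => f t i) : IsLocallyConstant f := by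
  rw [IsLocallyConstant.iff_eventually_eq]
  intro t
  filter_upwards [Filter.eventually_all.2 fun i => (h i).eventually_eq t] with t' ht'
  exact funext ht'

/-- An open subset of `U`, as an open set of regular semisimple matrices. -/
def imageOpens (U : Opens (TopCat.of (glrs d))) (W : Opens U) : Opens (TopCat.of (glrs d)) :=
  U.isOpenEmbedding.isOpenMap.functor.obj W

/-- The values of a section at the points of the fibres numbered by a continuous numbering of the
eigenvalues. -/
def sectionValues (n : ℕ) (e : ∀ y : U, EigenBasis y.1.1) (hc : Continuous fun y => (e y).val)
    (W : Opens U) :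
    (muTildeSheafRS n d).presheaf.obj (op (imageOpens U W))
      →ₗ[ℂ] LocallyConstant W ((Fin d → Fin n) → ℂ) where
  toFun s := ⟨fun y φ => evalAt s y.1.1 ⟨y.1, y.2, rfl⟩ ((e y.1).fiberPoint φ) rfl,
    isLocallyConstant_pi fun φ => isLocallyConstant_evalAt s
      (continuous_fiberPoint (x := fun y : W => y.1.1.1) (by fun_prop) (fun y : W => e y.1)
        (fun y => (e y.1).val_injective y.1.1.2) (hc.comp continuous_subtype_val) φ)
      (fun y => ⟨y.1, y.2, rfl⟩) (fun _ => rfl)⟩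
  map_add' _ _ := rfl
  map_smul' _ _ := rfl

theorem sectionValues_injective (e : ∀ y : U, EigenBasis y.1.1)
    (hc : Continuous fun y => (e y).val) (W : Opens U) :
    Function.Injective (sectionValues n e hc W) := by
  intro s t hst
  refine section_ext fun x hx F hF => ?_
  obtain ⟨u, hu, rfl⟩ := hx
  obtain ⟨φ, rfl⟩ := exists_fiberPoint_eq (e u) ((e u).val_injective u.1.2) F hF
  have := DFunLike.congr_fun hst ⟨u, hu⟩
  exact congrFun this φ

/-- A prescribed `f` is realized by taking, at a point over `y` with label `φ`, the value `f y φ`;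
the label is locally constant by `exists_label`. -/
theorem sectionValues_surjective (e : ∀ y : U, EigenBasis y.1.1)
    (hc : Continuous fun y => (e y).val) (W : Opens U) :
    Function.Surjective (sectionValues n e hc W) := by
  intro f
  obtain ⟨label, hl⟩ := exists_label n e hc
  let O : Opens (glrs d) := imageOpens U W
  have hOU : O ≤ U := by
    rintro _ ⟨u, -, rfl⟩
    exact u.2
  let j : fiberDomain n O → fiberDomain n U := fun F => ⟨F.1, by
    obtain ⟨y, hy, h⟩ := F.2
    exact ⟨y, hOU hy, h⟩⟩
  have hj : Continuous j := continuous_subtype_val.subtype_mk _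
  let b : fiberDomain n O → W := fun F => ⟨(j F).base, by
    obtain ⟨_, ⟨u, hu, rfl⟩, h⟩ := F.2
    have : u = (j F).base := Subtype.ext (Subtype.ext h)
    exact this ▸ hu⟩
  have hb : Continuous b := (fiberDomain.continuous_base.comp hj).subtype_mk _
  have hloc : IsLocallyConstant fun F => f (b F) (label (j F)) := by
    rw [IsLocallyConstant.iff_eventually_eq]
    intro F
    filter_upwards [(f.isLocallyConstant.comp_continuous hb).eventually_eq F,
      (label.isLocallyConstant.comp_continuous hj).eventually_eq F] with F' h1 h2
    exact (congrFun h1 _).trans (congrArg (f (b F)) h2)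
  refine ⟨sectionOf (U := O) ⟨_, hloc⟩, ?_⟩
  refine LocallyConstant.ext fun y => funext fun φ => ?_
  exact congrArg (f y) (label_fiberPoint hl y.1 φ ⟨y.1.1, y.1.2, rfl⟩)

/-- Over an open set where the eigenvalues are numbered continuously, sections of the direct image
are locally constant functions with values in functions of the numberings. -/
def sectionEquiv (n : ℕ) (e : ∀ y : U, EigenBasis y.1.1) (hc : Continuous fun y => (e y).val)
    (W : Opens U) :
    (muTildeSheafRS n d).presheaf.obj (op (imageOpens U W))
      ≃ₗ[ℂ] LocallyConstant W ((Fin d → Fin n) → ℂ) :=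
  LinearEquiv.ofBijective (sectionValues n e hc W)
    ⟨sectionValues_injective e hc W, sectionValues_surjective e hc W⟩

theorem isLocalSystem_muTildeSheafRS (n d : ℕ) : IsLocalSystem (muTildeSheafRS n d) := by
  intro x
  obtain ⟨e₀, -⟩ := (show glrs d from x).2
  obtain ⟨U, hxU, e, -, hc⟩ := exists_local_eigenBasis x e₀
  refine ⟨U, hxU, ModuleCat.of ℂ ((Fin d → Fin n) → ℂ),
    inferInstanceAs (Module.Finite ℂ ((Fin d → Fin n) → ℂ)), ⟨?_⟩⟩
  refine (fullyFaithfulSheafToPresheaf _ _).preimageIso ?_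
  refine NatIso.ofComponents (fun W => LinearEquiv.toModuleIso (sectionEquiv n e hc W.unop)) ?_
  intro W W' i
  ext s
  rfl

/-- Germs are determined by their values on the fibre, which are arbitrary. -/
def stalkEquiv (n : ℕ) {x : glrs d} (e : EigenBasis x.1) :
    (muTildeSheafRS n d).presheaf.stalk x ≃ₗ[ℂ] ((Fin d → Fin n) → ℂ) :=
  LinearEquiv.ofBijective
    (LinearMap.pi fun φ => evalStalk (n := n) (x : TopCat.of (glrs d)) (e.fiberPoint φ) rfl) <| by
  obtain ⟨U, hxU, e', hval, hc⟩ := exists_local_eigenBasis x e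
  have hpt : ∀ φ : Fin d → Fin n, (e' ⟨x, hxU⟩).fiberPoint φ = e.fiberPoint φ :=
    fiberPoint_eq_of_val_eq e _ (e.val_injective x.2) hval
  constructor
  · rw [← LinearMap.ker_eq_bot, LinearMap.ker_eq_bot']
    intro a ha
    obtain ⟨V, hxV, s, rfl⟩ := (muTildeSheafRS n d).presheaf.exists_germ_eq a
    have ha' : ∀ φ : Fin d → Fin n, evalAt s x hxV (e.fiberPoint φ) rfl = 0 := fun φ =>
      (evalStalk_germ _ _ _ _ _ _).symm.trans (congrFun ha φ)
    let V' : Opens (glrs d) := V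
    let Y := {y : glrs d // y ∈ U ∧ y ∈ V'}
    have hloc : ∀ φ : Fin d → Fin n, IsLocallyConstant fun y : Y =>
        evalAt s y.1 y.2.2 ((e' ⟨y.1, y.2.1⟩).fiberPoint φ) rfl := fun φ =>
      isLocallyConstant_evalAt s (continuous_fiberPoint
        (continuous_subtype_val.comp continuous_subtype_val) (fun y : Y => e' ⟨y.1, y.2.1⟩)
        (fun y => (e' _).val_injective y.1.2)
        (hc.comp (continuous_subtype_val.subtype_mk _)) φ) _ _
    -- There are finitely many `φ`, so all the values vanish on a common neighbourhood of `x`, where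
    -- the numbered points exhaust the fibres.
    have hev : ∀ᶠ y : Y in 𝓝 ⟨x, hxU, hxV⟩, ∀ φ : Fin d → Fin n,
        evalAt s y.1 y.2.2 ((e' ⟨y.1, y.2.1⟩).fiberPoint φ) rfl = 0 :=
      Filter.eventually_all.2 fun φ => by
        filter_upwards [(hloc φ).eventually_eq ⟨x, hxU, hxV⟩] with y hy
        rw [hy]
        simp only [hpt]
        exact ha' φ
    obtain ⟨N, hN, hNo, hxN⟩ := eventually_nhds_iff.1 hev
    let N' : Opens (TopCat.of (glrs d)) := ⟨Subtype.val '' N,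
      ((U ⊓ V').isOpen.isOpenEmbedding_subtypeVal.isOpenMap) _ hNo⟩
    have hxN' : x ∈ N' := ⟨_, hxN, rfl⟩
    have hN'V : N' ≤ V := by
      rintro _ ⟨y, -, rfl⟩
      exact y.2.2
    rw [← (muTildeSheafRS n d).presheaf.germ_res_apply (homOfLE hN'V) x hxN']
    have : (muTildeSheafRS n d).presheaf.map (homOfLE hN'V).op s = 0 := by
      refine section_ext fun y hy F hF => ?_
      obtain ⟨y, hyN, rfl⟩ := hy
      obtain ⟨φ, rfl⟩ := exists_fiberPoint_eq (e' ⟨y.1, y.2.1⟩)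
        ((e' _).val_injective y.1.2) F hF
      exact hN y hyN φ
    rw [this, map_zero]
  · intro c
    obtain ⟨label, hl⟩ := exists_label n e' hc
    refine ⟨(muTildeSheafRS n d).presheaf.germ (X := TopCat.of (glrs d)) U x hxU
      (sectionOf ⟨fun F => c (label F), label.isLocallyConstant.comp c⟩), ?_⟩
    funext φ
    refine (evalStalk_germ _ _ _ _ _ _).trans ?_
    have h1 := label_fiberPoint hl ⟨x, hxU⟩ φ ⟨x, hxU, rfl⟩
    simp only [hpt] at h1
    exact congrArg c h1

end LocalTriviality

/-! ### Monodromy of germs -/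

section Monodromy

variable {n d : ℕ}

/-- The end points of a loop are only propositionally equal to `x`, so eigenbases at the two
matrices have different types. -/
theorem fiberPoint_congr {x x' : gl d} (h : x = x') (e : EigenBasis x) (e' : EigenBasis x')
    (he : Function.Injective e'.val) (hval : e.val = e'.val) (φ : Fin d → Fin n) :
    e.fiberPoint φ = e'.fiberPoint φ := by
  subst h
  exact fiberPoint_eq_of_val_eq e' e he hval φ

/-- Evaluation of points of the étalé space. -/
def evalEtale (p : (muTildeSheafRS n d).presheaf.EtaleSpace) (F : Mperp n d)
    (h : F.1.1 = (show glrs d from p.base).1) : ℂ :=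
  evalStalk p.base F h p.germ

/-- By the topology of the étalé space, the germs `p t` for `t` near `t₀` all come from a single
section, which is locally constant along `F`. -/
theorem isLocallyConstant_evalEtale {T : Type*} [TopologicalSpace T]
    {p : T → (muTildeSheafRS n d).presheaf.EtaleSpace} (hp : Continuous p) {F : T → Mperp n d}
    (hF : Continuous F) (h : ∀ t, (F t).1.1 = (show glrs d from (p t).base).1) :
    IsLocallyConstant fun t => evalEtale (p t) (F t) (h t) := by
  rw [IsLocallyConstant.iff_eventually_eq]
  intro t₀
  obtain ⟨V, hV, s, hs⟩ := (muTildeSheafRS n d).presheaf.exists_germ_eq (p t₀).germ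
  have h1 := hp.continuousAt.eventually ((p t₀).eventually_nhds hV s hs)
  have hY : IsOpen {t | (p t).base ∈ V} :=
    V.isOpen.preimage ((TopCat.Presheaf.EtaleSpace.continuous_base _).comp hp)
  have hloc : IsLocallyConstant fun t : {t | (p t).base ∈ V} =>
      evalAt s (p t.1).base t.2 (F t.1) (h t.1) :=
    isLocallyConstant_evalAt s (hF.comp continuous_subtype_val) _ _
  have h2 := hloc.eventually_eq ⟨t₀, hV⟩
  rw [nhds_subtype_eq_comap, Filter.eventually_comap] at h2
  filter_upwards [h1, h2] with t ht1 ht2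
  obtain ⟨htV, htg⟩ := ht1
  have h3 : evalEtale (p t) (F t) (h t) = evalAt s (p t).base htV (F t) (h t) := by
    rw [evalEtale, htg, evalStalk_germ]
  have h4 : evalEtale (p t₀) (F t₀) (h t₀) = evalAt s (p t₀).base hV (F t₀) (h t₀) := by
    rw [evalEtale, ← hs, evalStalk_germ]
  rw [h3, h4]
  exact ht2 ⟨t, htV⟩ rfl

theorem stalkEquiv_apply {x : glrs d} (e : EigenBasis x.1)
    (a : (muTildeSheafRS n d).presheaf.stalk x) (φ : Fin d → Fin n) :
    stalkEquiv n e a φ = evalEtale ⟨x, a⟩ (e.fiberPoint φ) rfl := rfl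

/-- The monodromy along a loop is the end point of its lift to the étalé space. -/
theorem monodromyAction_mk {X : TopCat.{0}} [LocallyConnectedSpace X]
    {F : X.Sheaf (ModuleCat.{0} ℂ)} (hF : IsLocalSystem F) {x : X} (γ : Path x x)
    (a : F.presheaf.stalk x) :
    (⟨x, monodromyAction hF x (FundamentalGroup.fromPath (Path.Homotopic.Quotient.mk γ)) a⟩ :
      F.presheaf.EtaleSpace) = hF.isCoveringMap.liftPath γ.toContinuousMap ⟨x, a⟩ γ.source 1 :=
  congrArg Subtype.val ((fiberEquivStalk F x).symm_apply_apply
    (hF.isCoveringMap.monodromy (Path.Homotopic.Quotient.mk γ) ⟨⟨x, a⟩, rfl⟩))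

theorem fiberPoint_reindex {x : gl d} (e : EigenBasis x) (σ : Equiv.Perm (Fin d))
    (φ : Fin d → Fin n) : (e.reindex σ).fiberPoint φ = e.fiberPoint (φ ∘ σ.symm) :=
  Subtype.ext (congrArg (Prod.mk x) (e.flagOfMap_reindex σ φ))

/-- The value of a germ at a point of the fibre does not change under continuation of both. -/
theorem evalEtale_lift {x y : glrs d} (γ : Path x y)
    (Γ : C(unitInterval, (muTildeSheafRS n d).presheaf.EtaleSpace))
    (hΓ : ∀ t, (Γ t).base = γ t) (e : ∀ t, EigenBasis (γ t).1)
    (hec : Continuous fun t => (e t).val) (φ : Fin d → Fin n) {F₀ F₁ : Mperp n d}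
    (h₀ : (e 0).fiberPoint φ = F₀) (h₁ : (e 1).fiberPoint φ = F₁)
    {p₀ p₁ : (muTildeSheafRS n d).presheaf.EtaleSpace} (hp₀ : Γ 0 = p₀) (hp₁ : Γ 1 = p₁)
    (hb₀ : F₀.1.1 = (show glrs d from p₀.base).1) (hb₁ : F₁.1.1 = (show glrs d from p₁.base).1) :
    evalEtale p₁ F₁ hb₁ = evalEtale p₀ F₀ hb₀ := by
  subst h₀ h₁ hp₀ hp₁
  exact (isLocallyConstant_evalEtale Γ.continuous
    (continuous_fiberPoint (continuous_subtype_val.comp γ.continuous) e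
      (fun t => (e t).val_injective (γ t).2) hec φ)
    (fun t => congrArg Subtype.val (hΓ t).symm)).apply_eq_of_preconnectedSpace 1 0

theorem stalkEquiv_monodromyAction_mk (hL : IsLocalSystem (muTildeSheafRS n d)) {x : glrs d}
    (e : EigenBasis x.1) (γ : Path x x)
    (a : (muTildeSheafRS n d).presheaf.stalk x) (φ : Fin d → Fin n) :
    stalkEquiv n e (monodromyAction hL x
        (FundamentalGroup.fromPath (Path.Homotopic.Quotient.mk γ)) a) φ =
      stalkEquiv n e a
        (φ ∘ e.permHom (FundamentalGroup.fromPath (Path.Homotopic.Quotient.mk γ))) := by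
  rw [stalkEquiv_apply, stalkEquiv_apply]
  generalize hσ : e.permHom (FundamentalGroup.fromPath (Path.Homotopic.Quotient.mk γ)) = σ
  obtain ⟨e', he0, hec⟩ := exists_eigenBasis_path γ e
  -- The carried numbering ends as the original one precomposed with `σ`, by the characterization of
  -- `permHom`.
  have he1 : (e' 1).val = (e.reindex σ).val := by
    funext i
    rw [← hσ]
    exact (e.val_permHom γ ((continuous_apply i).comp hec)
      (fun t => ((e' t).hasEigenvalue_iff _).2 ⟨i, rfl⟩) (congrFun he0 i)).symm
  have hF0 : (e' 0).fiberPoint (φ ∘ σ) = e.fiberPoint (φ ∘ σ) :=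
    fiberPoint_congr (congrArg Subtype.val γ.source) _ _ (e.val_injective x.2) he0 _
  have hF1 : (e' 1).fiberPoint (φ ∘ σ) = e.fiberPoint φ := by
    rw [fiberPoint_congr (congrArg Subtype.val γ.target) (e' 1) (e.reindex σ)
      ((e.reindex σ).val_injective x.2) he1, fiberPoint_reindex, Function.comp_assoc,
      Equiv.self_comp_symm, Function.comp_id]
  exact evalEtale_lift γ _
    (fun t => congrFun (hL.isCoveringMap.liftPath_lifts γ.toContinuousMap ⟨x, a⟩ γ.source) t)
    e' hec (φ ∘ σ) hF0 hF1 (hL.isCoveringMap.liftPath_zero _ _ _) (monodromyAction_mk hL γ a).symm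
    rfl rfl

theorem stalkEquiv_monodromyAction (hL : IsLocalSystem (muTildeSheafRS n d)) {x : glrs d}
    (e : EigenBasis x.1) (γ : FundamentalGroup (glrs d) x)
    (a : (muTildeSheafRS n d).presheaf.stalk x) (φ : Fin d → Fin n) :
    stalkEquiv n e (monodromyAction hL x γ a) φ = stalkEquiv n e a (φ ∘ e.permHom γ) := by
  obtain ⟨γ, rfl⟩ := Path.Homotopic.Quotient.mk_surjective γ
  exact stalkEquiv_monodromyAction_mk hL e γ a φ

end Monodromy

/-! ### Surjectivity onto the symmetric group -/

section Surjectivity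

variable {d : ℕ}

/-- The matrix whose columns are the vectors of an eigenbasis. -/
def EigenBasis.colMatrix {x : gl d} (e : EigenBasis x) : gl d := Matrix.of fun i j => e.vec j i

theorem EigenBasis.det_colMatrix_ne_zero {x : gl d} (e : EigenBasis x) : e.colMatrix.det ≠ 0 := by
  have h : e.colMatrix = (EuclideanSpace.basisFun (Fin d) ℂ).toBasis.toMatrix e.vec := by
    ext i j
    simp [colMatrix, Module.Basis.toMatrix_apply]
  have h2 := (EuclideanSpace.basisFun (Fin d) ℂ).toBasis.toMatrix_mul_toMatrix_flip e.vec
  rw [h]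
  intro h0
  have := congrArg Matrix.det h2
  rw [Matrix.det_mul, h0] at this
  simp at this

theorem EigenBasis.eq_conj_diagonal {x : gl d} (e : EigenBasis x) :
    e.colMatrix * Matrix.diagonal e.val * e.colMatrix⁻¹ = x := by
  have h : x * e.colMatrix = e.colMatrix * Matrix.diagonal e.val := by
    ext i j
    have := congrArg (fun v : Cd d => v i) (e.apply_vec j)
    rw [Matrix.mul_diagonal]
    simpa [colMatrix, Matrix.mul_apply, Matrix.mulVec, dotProduct, mul_comm] using this
  rw [← h, Matrix.mul_nonsing_inv_cancel_right _ _ e.det_colMatrix_ne_zero.isUnit]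

theorem hasEigenvalue_conj_diagonal {h : gl d} (hh : h.det ≠ 0) (l : Fin d → ℂ) (i : Fin d) :
    Module.End.HasEigenvalue (Matrix.toEuclideanLin (h * Matrix.diagonal l * h⁻¹)) (l i) := by
  refine Module.End.hasEigenvalue_of_hasEigenvector
    (x := WithLp.toLp 2 (h.mulVec (Pi.single i 1))) ⟨Module.End.mem_eigenspace_iff.2 ?_, ?_⟩
  · refine (WithLp.ofLp_injective 2) ?_
    simp only [Matrix.toEuclideanLin, Matrix.toLpLin_apply, WithLp.ofLp_smul]
    rw [Matrix.mulVec_mulVec, Matrix.nonsing_inv_mul_cancel_right _ _ hh.isUnit,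
      ← Matrix.mulVec_mulVec, ← Matrix.mulVec_smul]
    congr 1
    ext j
    rcases eq_or_ne j i with rfl | hj
    · simp [Matrix.mulVec_diagonal]
    · simp [Matrix.mulVec_diagonal, hj]
  · intro h0
    have h1 : h.mulVec (Pi.single i 1) = 0 := congrArg WithLp.ofLp h0
    have h2 := Matrix.eq_zero_of_mulVec_eq_zero hh h1
    simpa using congrFun h2 i

/-- The determinant is a polynomial in `z` whose value at `0` is `det A ≠ 0`. -/
theorem finite_det_add_smul_eq_zero {A : gl d} (B : gl d) (hA : A.det ≠ 0) :
    {z : ℂ | (A + z • B).det = 0}.Finite := by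
  let q : ℂ[X] := (A.map C + (X : ℂ[X]) • B.map C).det
  have hq : ∀ z, q.eval z = (A + z • B).det := by
    intro z
    rw [← coe_evalRingHom, RingHom.map_det]
    congr 1
    ext i j
    simp [mul_comm z]
  have hq0 : q ≠ 0 := by
    intro h0
    have := hq 0
    rw [h0] at this
    simp at this
    exact hA this.symm
  refine (q.rootSet_finite ℂ).subset fun z hz => ?_
  rw [mem_rootSet]
  refine ⟨hq0, ?_⟩
  simpa [hq] using hz

/-- Both `e` and its renumbering by `σ` diagonalize the same `x`. Joining their eigenvector matrices
and eigenvalue tuples through invertible matrices and injective tuples gives a loop at `x` that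
moves `λ_i` to `λ_{σ(i)}`. -/
theorem EigenBasis.permHom_surjective {x : glrs d} (e : EigenBasis x.1) :
    Function.Surjective e.permHom := by
  intro σ
  have hinj := e.val_injective x.2
  let e₁ := e.reindex σ
  let h : ℂ → gl d := fun z => e.colMatrix + z • (e₁.colMatrix - e.colMatrix)
  let l : ℂ → Fin d → ℂ := fun z => e.val + z • (e₁.val - e.val)
  have hh0 : h 0 = e.colMatrix := by simp [h]
  have hh1 : h 1 = e₁.colMatrix := by simp [h]
  have hl0 : l 0 = e.val := by simp [l]
  have hl1 : l 1 = e₁.val := by simp [l]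
  -- Parameters on the complex line joining the two data where the matrix is singular or two
  -- eigenvalues collide.
  let bad : Set ℂ := {z | (h z).det = 0} ∪ ⋃ p ∈ {p : Fin d × Fin d | p.1 ≠ p.2},
    {z | l z p.1 = l z p.2}
  have hbad : bad.Finite := by
    refine (finite_det_add_smul_eq_zero _ e.det_colMatrix_ne_zero).union
      ((Set.toFinite _).biUnion fun p hp => ?_)
    refine Set.Subsingleton.finite fun z hz w hw => ?_
    simp only [l, Set.mem_ofPred_eq, Pi.add_apply, Pi.smul_apply, Pi.sub_apply, smul_eq_mul]
      at hz hw
    by_contra hzw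
    have h1 : (z - w) * ((e₁.val p.1 - e.val p.1) - (e₁.val p.2 - e.val p.2)) = 0 := by
      linear_combination hz - hw
    rcases mul_eq_zero.1 h1 with h2 | h2
    · exact hzw (sub_eq_zero.1 h2)
    -- If the two affine functions have equal slopes, one collision forces equal constant terms,
    -- that is, equal eigenvalues of `x`.
    · refine hp (hinj ?_)
      linear_combination hz - z * h2
  have hgood : ∀ z, z ∉ bad → (h z).det ≠ 0 ∧ Function.Injective (l z) := by
    intro z hz
    simp only [bad, Set.mem_union, Set.mem_iUnion, not_or, not_exists] at hz
    exact ⟨hz.1, fun i j hij => by_contra fun hne => hz.2 (i, j) hne hij⟩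
  have h0 : (0 : ℂ) ∈ badᶜ := by
    simp only [bad, Set.mem_compl_iff, Set.mem_union, Set.mem_iUnion, not_or, not_exists,
      Set.mem_ofPred_eq, hh0, hl0]
    exact ⟨e.det_colMatrix_ne_zero, fun p hp h => hp (hinj h)⟩
  have h1 : (1 : ℂ) ∈ badᶜ := by
    simp only [bad, Set.mem_compl_iff, Set.mem_union, Set.mem_iUnion, not_or, not_exists,
      Set.mem_ofPred_eq, hh1, hl1]
    exact ⟨e₁.det_colMatrix_ne_zero, fun p hp h => hp (e₁.val_injective x.2 h)⟩
  -- The plane has real dimension two, so the complement of a finite set in it is path connected and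
  -- the bad parameters can be avoided.
  obtain ⟨δ, hδ⟩ := (hbad.countable.isPathConnected_compl_of_one_lt_rank
    (by rw [Complex.rank_real_complex]; norm_num)).joinedIn 0 h0 1 h1
  have hδ' := fun t => hgood (δ t) (hδ t)
  let y : unitInterval → gl d := fun t => h (δ t) * Matrix.diagonal (l (δ t)) * (h (δ t))⁻¹
  have hev : ∀ t i, Module.End.HasEigenvalue (Matrix.toEuclideanLin (y t)) (l (δ t) i) :=
    fun t i => hasEigenvalue_conj_diagonal (hδ' t).1 _ i
  have hy : ∀ t, IsRegularSemisimple (y t) := fun t => by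
    obtain ⟨e', he'⟩ := EigenBasis.exists_val_eq (hδ' t).2 (hev t)
    exact ⟨e', he' ▸ (hδ' t).2⟩
  have hhc : Continuous fun t => h (δ t) :=
    continuous_const.add (δ.continuous.smul continuous_const)
  have hlc : Continuous fun t => l (δ t) :=
    continuous_const.add (δ.continuous.smul continuous_const)
  have hyc : Continuous y := by
    refine (hhc.matrix_mul hlc.matrix_diagonal).matrix_mul ?_
    simp only [Matrix.inv_def, Ring.inverse_eq_inv']
    exact (hhc.matrix_det.inv₀ fun t => (hδ' t).1).smul hhc.matrix_adjugate
  let γ : Path x x :=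
    { toFun := fun t => ⟨y t, hy t⟩
      continuous_toFun := hyc.subtype_mk _
      source' := Subtype.ext (by
        simp only [y, δ.source, hh0, hl0]
        exact e.eq_conj_diagonal)
      target' := Subtype.ext (by
        simp only [y, δ.target, hh1, hl1]
        exact e₁.eq_conj_diagonal) }
  refine ⟨FundamentalGroup.fromPath (Path.Homotopic.Quotient.mk γ), Equiv.ext fun i => hinj ?_⟩
  rw [e.val_permHom γ ((continuous_apply i).comp hlc) (fun t => hev t i)
    (by simp only [Function.comp_apply, δ.source, hl0])]
  simp only [Function.comp_apply, δ.target, hl1]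
  rfl

end Surjectivity

/-! ### Permutations of tensor coordinates and the main theorem -/

/-- The permutation `σ` sends the pure tensor of `ψ` to that of `ψ ∘ σ⁻¹`, so the new coefficient at
`φ` is the old one at `φ ∘ σ`, matching `stalkEquiv_monodromyAction`. -/
theorem tensorPerm_sum {n d : ℕ} (f : Fin n → Fin n → ℂ) (σ : Equiv.Perm (Fin d))
    (c : (Fin d → Fin n) → ℂ) :
    tensorPerm n d σ (∑ φ, c φ • PiTensorProduct.tprod ℂ fun i => f (φ i)) =
      ∑ φ : Fin d → Fin n, c (φ ∘ σ) • PiTensorProduct.tprod ℂ fun i => f (φ i) := by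
  rw [map_sum]
  refine Fintype.sum_equiv (σ.arrowCongr (Equiv.refl _)) _ _ fun φ => ?_
  have h : (σ.arrowCongr (Equiv.refl (Fin n)) φ) ∘ σ = φ := by
    funext i
    simp [Equiv.arrowCongr]
  rw [map_smul, h]
  congr 1
  exact PiTensorProduct.reindex_tprod (s := fun _ => Fin n → ℂ) σ fun i => f (φ i)

end FlagMonodromy

end

open FlagMonodromy
theorem lemma10p2 (n d : ℕ) (hn : 1 ≤ n) (hd : 1 ≤ d) (x : glrs d) (e : EigenBasis x.1) :
    ∃ hL : IsLocalSystem (muTildeSheafRS n d),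
    ∃ ρ : FundamentalGroup (glrs d) x →* Equiv.Perm (Fin d),
      Function.Surjective ρ ∧
      (∀ (γ : Path x x) (i : Fin d), ∃ l : C(unitInterval, ℂ),
        l 0 = e.val i ∧
        (∀ t, Module.End.HasEigenvalue (Matrix.toEuclideanLin (γ t).1) (l t)) ∧
        l 1 = e.val (ρ (FundamentalGroup.fromPath (Path.Homotopic.Quotient.mk γ)) i)) ∧
      ∀ f : Module.Basis (Fin n) ℂ (Fin n → ℂ),
        ∃ T : (muTildeSheafRS n d).presheaf.stalk x ≃ₗ[ℂ] (⨂[ℂ] _ : Fin d, (Fin n → ℂ)),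
          (∀ (U : Opens (glrs d)) (hx : x ∈ U) (s : (muTildeSheafRS n d).presheaf.obj (op U)),
            T ((muTildeSheafRS n d).presheaf.germ U x hx s) =
              ∑ φ : Fin d → Fin n, evalAt s x hx (e.fiberPoint φ) rfl •
                PiTensorProduct.tprod ℂ (fun i => f (φ i))) ∧
          ∀ (γ : FundamentalGroup (glrs d) x) (a : (muTildeSheafRS n d).presheaf.stalk x),
            T (monodromyAction hL x γ a) = tensorPerm n d (ρ γ) (T a) := by
  have hL := isLocalSystem_muTildeSheafRS n d
  refine ⟨hL, e.permHom, e.permHom_surjective, fun γ i => ?_, fun f => ?_⟩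
  · obtain ⟨e', he0, hec⟩ := exists_eigenBasis_path γ e
    have hc : Continuous fun t => (e' t).val i := (continuous_apply i).comp hec
    have hev := fun t => ((e' t).hasEigenvalue_iff _).2 ⟨i, rfl⟩
    exact ⟨⟨_, hc⟩, congrFun he0 i, hev, (e.val_permHom γ hc hev (congrFun he0 i)).symm⟩
  · let b := Basis.piTensorProduct fun _ : Fin d => f
    let T := (stalkEquiv n e).trans b.equivFun.symm
    have hT : ∀ a, T a = ∑ φ : Fin d → Fin n,
        stalkEquiv n e a φ • PiTensorProduct.tprod ℂ (fun i => f (φ i)) := fun a => by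
      simp only [T, b, LinearEquiv.trans_apply, Module.Basis.equivFun_symm_apply,
        Basis.piTensorProduct_apply]
    refine ⟨T, fun U hx s => ?_, fun γ a => ?_⟩
    · rw [hT]
      exact Finset.sum_congr rfl fun φ _ => congrArg (· • _) (evalStalk_germ _ _ _ _ _ _)
    · rw [hT, hT, tensorPerm_sum]
      exact Finset.sum_congr rfl fun φ _ =>
        congrArg (· • _) (stalkEquiv_monodromyAction hL e γ a φ)
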